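/- All lattices and ordered sets are nonempty. For a lattice $L$ and $a,b\in L$, let $\operatorname{con}(a,b)$ be the least lattice congruence of $L$ collapsing $a$ and $b$; congruences of this form are called principal, and $\operatorname{Princ}(L)$ denotes the set of all principal congruences of $L$ ordered by inclusion. "Countable" means finite or countably infinite. An ordered set $P$ is directed if any two of its elements have an upper bound in $P$. A principal ideal of $P$ is a subset of the form $\{x\in P : x\le c\}$ with $c\in P$. Theorem 1.1. (i) An ordered set $P$ is isomorphic to $\operatorname{Princ}(L)$ for some countable lattice $L$ if and only if $P$ is countable, directed, and has a least element. (ii) If $P$ is an ordered set with a least element and $P$ is the union of a chain (with respect to inclusion) of principal ideals, then there exists a lattice $L$ such that $P\cong\operatorname{Princ}(L)$. Moreover, an ordered set $P$ is the union of a chain of principal ideals if and only if it has a cofinal chain, that is, a chain $C\subseteq P$ such that every $x\in P$ satisfies $x\le c$ for some $c\in C$. -/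

import Mathlib

universe u v

namespace PrincCong

/-- Lattice congruences ordered by inclusion of relations:
`c ≤ d` iff every pair related by `c` is related by `d`. -/
instance instPartialOrderLatticeCon (L : Type u) [Lattice L] : PartialOrder (LatticeCon L) where
  le c d := ∀ ⦃x y : L⦄, c.r x y → d.r x y
  le_refl _ _ _ h := h
  le_trans _ _ _ h₁ h₂ _ _ h := h₂ (h₁ h)
  le_antisymm c d h₁ h₂ := by
    obtain ⟨⟨r, hr⟩, _, _⟩ := c
    obtain ⟨⟨s, hs⟩, _, _⟩ := d
    have : r = s := by
      funext x y
      exact propext ⟨fun h => h₁ h, fun h => h₂ h⟩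
    subst this
    rfl

/-- The congruence of `L` generated by the pair `(a, b)`: the intersection of all lattice
congruences that collapse `a` and `b`. -/
def con {L : Type u} [Lattice L] (a b : L) : LatticeCon L where
  r x y := ∀ c : LatticeCon L, c.r a b → c.r x y
  iseqv :=
    { refl := fun x c _ => c.iseqv.refl x
      symm := fun h c hc => c.iseqv.symm (h c hc)
      trans := fun h₁ h₂ c hc => c.iseqv.trans (h₁ c hc) (h₂ c hc) }
  inf h₁ h₂ c hc := c.inf (h₁ c hc) (h₂ c hc)
  sup h₁ h₂ c hc := c.sup (h₁ c hc) (h₂ c hc)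

/-- `con a b` is the least congruence collapsing `a` and `b`. -/
theorem isLeast_con {L : Type u} [Lattice L] (a b : L) :
    IsLeast {c : LatticeCon L | c.r a b} (con a b) :=
  ⟨fun _ hc => hc, fun c hc _ _ h => h c hc⟩

/-- `Princ L`: the set of principal congruences of `L`, ordered by inclusion. -/
abbrev Princ (L : Type u) [Lattice L] : Type u :=
  {c : LatticeCon L // ∃ a b : L, c = con a b}

/-- `P` is the union of a chain (under inclusion) of principal ideals `{x | x ≤ c}`. -/
def IsUnionOfChainOfPrincipalIdeals (P : Type u) [PartialOrder P] : Prop :=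
  ∃ 𝒞 : Set (Set P),
    (∀ I ∈ 𝒞, ∃ c : P, I = Set.Iic c) ∧ IsChain (· ⊆ ·) 𝒞 ∧ ⋃₀ 𝒞 = Set.univ

/-- `P` has a cofinal chain. -/
def HasCofinalChain (P : Type u) [PartialOrder P] : Prop :=
  ∃ C : Set P, IsChain (· ≤ ·) C ∧ IsCofinal C

end PrincCong

/-! Necessity in (i) is general: for two pairs in any lattice, the meet and the join of all four
elements generate a congruence above both principal ones, and `con a a` is least. A countable
directed poset has a cofinal chain, so sufficiency in (i) and all of (ii) rest on one construction:
from a poset with least element `z` and a cofinal chain to a lattice.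

Call the elements other than `z` colors, and thin the chain to a well-ordered cofinal chain indexed
by `C`. The lattice is a nested union of intervals from `zero c` to `one c`, the zeros descending
and the ones ascending with the level `c`. Level `c` has, for each color `p` of rank at most `c`, an
interval from `A c p false` to `A c p true`. Three gadgets force the order on colors. For `p < q`
the joins `H` omit the combination (false, true), so collapsing `q` collapses `p`. The interval from
`Tu` to `Tv` is perspective to the intervals of color `p` at level `c` and at level `rank p`, so a
color means the same on every level. The mutually complementary `W c n`, with `W c 0` below `A c
(chain c) true`, make collapsing the color `chain c` equivalent to collapsing all of level `c`. The
`Tj` supply the remaining joins across levels.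

Elements are sets of generators. These sets are closed under intersection, and well-foundedness of
`C` then yields joins.

The congruence of color `r` is written down explicitly as `Sim`. The key lemma is `exists_absorbs`:
every `w` can be raised, inside its class, as far as needed, and every congruence collapsing `r`
makes the same identification. Hence `Sim` respects joins and is the least congruence collapsing
`r`. Finally `exists_hasColor` shows that each strict pair generates the congruence of some color,
so the nontrivial principal congruences form a copy of the colors, and `z` goes to equality. -/

namespace PrincCong

/-- An order embedding of a well-ordered type into a poset together with a map choosing, for every
element of the poset, an upper bound in the chain, every element of the chain being its own bound. -/
structure CofinalTower (Q C : Type u) [PartialOrder Q] [LinearOrder C] where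
  chain : C ↪o Q
  rank : Q → C
  le_chain_rank : ∀ p, p ≤ chain (rank p)
  rank_chain : ∀ c, rank (chain c) = c

/-- The generators: `o i` generates the zero of level `i`, `a i p false` and `a i p true` generate
the interval of color `p` at level `i`, and `w i n` generates a complement at level `i`. -/
inductive Gen (Q C : Type u) : Type u
  | o (i : C)
  | a (i : C) (p : Q) (s : Bool)
  | w (i : C) (n : Fin 3)

namespace Gen

variable {Q C : Type u}

/-- The level of a generator. -/
def level : Gen Q C → C
  | o i => i
  | a i _ _ => i
  | w i _ => i

end Gen

/-! ### Elements as sets of generators; closure under intersection -/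

namespace CofinalTower

variable {Q C : Type u} [PartialOrder Q] [LinearOrder C] (D : CofinalTower Q C)

/-- Names for the elements of the lattice attached to a cofinal tower. -/
inductive Elt : Type u
  | zero (c : C)
  | one (c : C)
  | A (c : C) (p : Q) (hp : D.rank p ≤ c) (s : Bool)
  | W (c : C) (n : Fin 3)
  | H (c : C) (p q : Q) (hpq : p < q) (hp : D.rank p ≤ c) (hq : D.rank q ≤ c)
      (s t : Bool) (hts : t = true → s = true)
  | Tu (c : C) (p : Q) (hp : D.rank p < c)
  | Tv (c : C) (p : Q) (hp : D.rank p < c)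
  | Tj (c : C) (p : Q) (k : C) (hp : D.rank p ≤ k) (hk : k < c)

variable {D}

/-- `x.Has g`: the generator `g` lies below the element named by `x`. -/
def Elt.Has : D.Elt → Gen Q C → Prop
  | .zero c, .o i => c ≤ i
  | .zero _, .a _ _ _ => False
  | .zero _, .w _ _ => False
  | .one _, .o _ => True
  | .one c, .a i _ _ => i ≤ c
  | .one c, .w i _ => i ≤ c
  | .A c _ _ _, .o i => c ≤ i
  | .A c p _ s, .a i p' s' => i = c ∧ p' = p ∧ (s' = true → s = true)
  -- This single incidence ties the color `chain c` to the whole of level `c`.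
  | .A c p _ s, .w i n => i = c ∧ p = D.chain c ∧ s = true ∧ n = 0
  | .W c _, .o i => c ≤ i
  | .W _ _, .a _ _ _ => False
  | .W c n, .w i n' => i = c ∧ n' = n
  | .H c _ _ _ _ _ _ _ _, .o i => c ≤ i
  | .H c p q _ _ _ s t _, .a i p' s' =>
      i = c ∧ (p' = p ∧ (s' = true → s = true) ∨ p' = q ∧ (s' = true → t = true))
  | .H c _ q _ _ _ _ t _, .w i n => i = c ∧ q = D.chain c ∧ t = true ∧ n = 0
  | .Tu _ p _, .o i => D.rank p ≤ i
  | .Tu c p _, .a i p' s' => (i = c ∨ i = D.rank p) ∧ p' = p ∧ s' = false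
  | .Tu _ _ _, .w _ _ => False
  | .Tv _ p _, .o i => D.rank p ≤ i
  | .Tv c p _, .a i p' _ => (i = c ∨ i = D.rank p) ∧ p' = p
  | .Tv _ p _, .w i n => i = D.rank p ∧ p = D.chain i ∧ n = 0
  | .Tj _ _ _ _ _, .o _ => True
  | .Tj c p k _ _, .a i p' _ => i ≤ k ∨ i = c ∧ p' = p
  | .Tj _ _ k _ _, .w i _ => i ≤ k

/-- The set of generators below an element. -/
def Elt.gens (x : D.Elt) : Set (Gen Q C) := {g | x.Has g}

theorem le_chain_of_rank_le {p : Q} {c : C} (h : D.rank p ≤ c) : p ≤ D.chain c :=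
  (D.le_chain_rank p).trans (D.chain.monotone h)

theorem ne_chain_of_lt {p q : Q} {c : C} (h : D.rank q ≤ c) (hpq : p < q) :
    p ≠ D.chain c := fun e => (hpq.trans_le (le_chain_of_rank_le h)).ne e

theorem rank_eq_of_eq_chain {p : Q} {c : C} (h : p = D.chain c) : D.rank p = c := by
  rw [h, D.rank_chain]

theorem Elt.exists_inter_of {x y : D.Elt} (z : D.Elt)
    (h : ∀ g, z.Has g ↔ x.Has g ∧ y.Has g := by
      rintro (i | ⟨i, r, b⟩ | ⟨i, n⟩) <;> grind [Elt.Has]) :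
    ∃ z : D.Elt, z.gens = x.gens ∩ y.gens := ⟨z, Set.ext h⟩

theorem Elt.exists_inter_comm {x y : D.Elt} (h : ∃ z : D.Elt, z.gens = x.gens ∩ y.gens) :
    ∃ z : D.Elt, z.gens = y.gens ∩ x.gens := by rwa [Set.inter_comm]

/-- Zeros descend as levels rise, so the common floor of two elements with floors `c` and `d` is the
zero of level `max c d`. -/
theorem Elt.exists_inter_zero (c : C) (y : D.Elt) :
    ∃ z : D.Elt, z.gens = (Elt.zero c : D.Elt).gens ∩ y.gens := by
  cases y with
  | zero d => exact exists_inter_of (.zero (max c d))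
  | one d => exact exists_inter_of (.zero c)
  | A d p hp s => exact exists_inter_of (.zero (max c d))
  | W d n => exact exists_inter_of (.zero (max c d))
  | H d p q hpq hp hq s t hts => exact exists_inter_of (.zero (max c d))
  | Tu d p hp => exact exists_inter_of (.zero (max c (D.rank p)))
  | Tv d p hp => exact exists_inter_of (.zero (max c (D.rank p)))
  | Tj d p k hp hk => exact exists_inter_of (.zero c)

theorem Elt.exists_inter_one (c : C) (y : D.Elt) :
    ∃ z : D.Elt, z.gens = (Elt.one c : D.Elt).gens ∩ y.gens := by
  cases y with
  | zero d => exact exists_inter_of (.zero d)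
  | one d => exact exists_inter_of (.one (min c d))
  | A d p hp s =>
    by_cases h : d ≤ c
    · exact exists_inter_of (.A d p hp s)
    · exact exists_inter_of (.zero d)
  | W d n =>
    by_cases h : d ≤ c
    · exact exists_inter_of (.W d n)
    · exact exists_inter_of (.zero d)
  | H d p q hpq hp hq s t hts =>
    by_cases h : d ≤ c
    · exact exists_inter_of (.H d p q hpq hp hq s t hts)
    · exact exists_inter_of (.zero d)
  | Tu d p hp =>
    by_cases h : d ≤ c
    · exact exists_inter_of (.Tu d p hp)
    · by_cases h' : D.rank p ≤ c
      · exact exists_inter_of (.A (D.rank p) p le_rfl false)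
      · exact exists_inter_of (.zero (D.rank p))
  | Tv d p hp =>
    by_cases h : d ≤ c
    · exact exists_inter_of (.Tv d p hp)
    · by_cases h' : D.rank p ≤ c
      · exact exists_inter_of (.A (D.rank p) p le_rfl true)
      · exact exists_inter_of (.zero (D.rank p))
  | Tj d p k hp hk =>
    by_cases h : d ≤ c
    · exact exists_inter_of (.Tj d p k hp hk)
    · exact exists_inter_of (.one (min c k))

theorem Elt.exists_inter_W (c : C) (n : Fin 3) (y : D.Elt) :
    ∃ z : D.Elt, z.gens = (Elt.W c n : D.Elt).gens ∩ y.gens := by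
  cases y with
  | zero d => exact exists_inter_comm (exists_inter_zero d _)
  | one d => exact exists_inter_comm (exists_inter_one d _)
  | A d p hp s =>
    by_cases h : c = d ∧ p = D.chain d ∧ s = true ∧ n = 0
    · exact exists_inter_of (.W c n)
    · exact exists_inter_of (.zero (max c d))
  | W d m =>
    by_cases h : c = d ∧ n = m
    · exact exists_inter_of (.W c n)
    · exact exists_inter_of (.zero (max c d))
  | H d p q hpq hp hq s t hts =>
    by_cases h : c = d ∧ q = D.chain d ∧ t = true ∧ n = 0
    · exact exists_inter_of (.W c n)
    · exact exists_inter_of (.zero (max c d))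
  | Tu d p hp => exact exists_inter_of (.zero (max c (D.rank p)))
  | Tv d p hp =>
    by_cases h : c = D.rank p ∧ p = D.chain c ∧ n = 0
    · exact exists_inter_of (.W c n)
    · exact exists_inter_of (.zero (max c (D.rank p)))
  | Tj d p k hp hk =>
    by_cases h : c ≤ k
    · exact exists_inter_of (.W c n)
    · exact exists_inter_of (.zero c)

theorem Elt.exists_inter_A_A (c : C) (p : Q) (hp : D.rank p ≤ c) (s : Bool)
    (d : C) (q : Q) (hq : D.rank q ≤ d) (t : Bool) :
    ∃ z : D.Elt, z.gens = (Elt.A c p hp s).gens ∩ (Elt.A d q hq t).gens := by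
  by_cases h : c = d ∧ p = q
  · exact exists_inter_of (.A c p hp (s && t))
  · exact exists_inter_of (.zero (max c d))

theorem Elt.exists_inter_A_H (c : C) (p : Q) (hp : D.rank p ≤ c) (s : Bool)
    (d : C) (p' q' : Q) (hpq' : p' < q') (hp' : D.rank p' ≤ d) (hq' : D.rank q' ≤ d)
    (s' t' : Bool) (hts' : t' = true → s' = true) :
    ∃ z : D.Elt, z.gens = (Elt.A c p hp s).gens ∩
      (Elt.H d p' q' hpq' hp' hq' s' t' hts').gens := by
  have e2 := ne_chain_of_lt hq' hpq'
  have e4 := hpq'.ne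
  by_cases h : c = d ∧ p = p'
  · exact exists_inter_of (.A c p hp (s && s'))
  · by_cases h' : c = d ∧ p = q'
    · exact exists_inter_of (.A c p hp (s && t'))
    · exact exists_inter_of (.zero (max c d))

theorem Elt.exists_inter_H_H (c : C) (p q : Q) (hpq : p < q) (hp : D.rank p ≤ c) (hq : D.rank q ≤ c)
    (s t : Bool) (hts : t = true → s = true)
    (d : C) (p' q' : Q) (hpq' : p' < q') (hp' : D.rank p' ≤ d) (hq' : D.rank q' ≤ d)
    (s' t' : Bool) (hts' : t' = true → s' = true) :
    ∃ z : D.Elt, z.gens = (Elt.H c p q hpq hp hq s t hts).gens ∩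
      (Elt.H d p' q' hpq' hp' hq' s' t' hts').gens := by
  have e1 := ne_chain_of_lt hq hpq
  have e2 := ne_chain_of_lt hq' hpq'
  have e3 := hpq.ne
  have e4 := hpq'.ne
  by_cases hc : c = d
  · subst hc
    by_cases h1 : p = p'
    · by_cases h2 : q = q'
      · exact exists_inter_of (.H c p q hpq hp hq (s && s') (t && t') (by grind))
      · exact exists_inter_of (.A c p hp (s && s'))
    · by_cases h2 : q = q'
      · exact exists_inter_of (.A c q hq (t && t'))
      · by_cases h3 : p = q'
        · have e5 : q ≠ p' := fun e => (hpq.trans_eq e |>.trans hpq' |>.trans_eq h3.symm).ne rfl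
          exact exists_inter_of (.A c p hp (s && t'))
        · by_cases h4 : q = p'
          · exact exists_inter_of (.A c q hq (t && s'))
          · exact exists_inter_of (.zero c)
  · exact exists_inter_of (.zero (max c d))

theorem Elt.exists_inter_Tu (c : C) (p : Q) (hp : D.rank p < c) (y : D.Elt) :
    ∃ z : D.Elt, z.gens = (Elt.Tu c p hp : D.Elt).gens ∩ y.gens := by
  cases y with
  | zero d => exact exists_inter_comm (exists_inter_zero d _)
  | one d => exact exists_inter_comm (exists_inter_one d _)
  | W d n => exact exists_inter_comm (exists_inter_W d n _)
  | A d q hq s =>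
    by_cases h : p = q ∧ (d = c ∨ d = D.rank p)
    · exact exists_inter_of (.A d q hq false)
    · exact exists_inter_of (.zero (max (D.rank p) d))
  | H d p' q' hpq' hp' hq' s t hts =>
    have e4 := hpq'.ne
    by_cases h : (p = p' ∨ p = q') ∧ (d = c ∨ d = D.rank p)
    · exact exists_inter_of (.A d p (by grind) false)
    · exact exists_inter_of (.zero (max (D.rank p) d))
  | Tu d q hq =>
    by_cases h : p = q
    · subst h
      by_cases h : c = d
      · exact exists_inter_of (.Tu c p hp)
      · exact exists_inter_of (.A (D.rank p) p le_rfl false)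
    · exact exists_inter_of (.zero (max (D.rank p) (D.rank q)))
  | Tv d q hq =>
    by_cases h : p = q
    · subst h
      by_cases h : c = d
      · exact exists_inter_of (.Tu c p hp)
      · exact exists_inter_of (.A (D.rank p) p le_rfl false)
    · exact exists_inter_of (.zero (max (D.rank p) (D.rank q)))
  | Tj d q k hq hk =>
    by_cases h : c ≤ k ∨ c = d ∧ p = q
    · exact exists_inter_of (.Tu c p hp)
    · by_cases h' : D.rank p ≤ k
      · exact exists_inter_of (.A (D.rank p) p le_rfl false)
      · exact exists_inter_of (.zero (D.rank p))

theorem Elt.exists_inter_Tv (c : C) (p : Q) (hp : D.rank p < c) (y : D.Elt) :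
    ∃ z : D.Elt, z.gens = (Elt.Tv c p hp : D.Elt).gens ∩ y.gens := by
  have e (d : C) (q : Q) (h : q = D.chain d) : D.rank q = d := rank_eq_of_eq_chain h
  cases y with
  | zero d => exact exists_inter_comm (exists_inter_zero d _)
  | one d => exact exists_inter_comm (exists_inter_one d _)
  | W d n => exact exists_inter_comm (exists_inter_W d n _)
  | Tu d q hq => exact exists_inter_comm (exists_inter_Tu d q hq _)
  | A d q hq s =>
    have := e d q
    by_cases h : p = q ∧ (d = c ∨ d = D.rank p)
    · exact exists_inter_of (.A d q hq s)
    · exact exists_inter_of (.zero (max (D.rank p) d))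
  | H d p' q' hpq' hp' hq' s t hts =>
    have e4 := hpq'.ne
    have e2 := ne_chain_of_lt hq' hpq'
    have := e d q'
    by_cases h : p = p' ∧ (d = c ∨ d = D.rank p)
    · exact exists_inter_of (.A d p (by grind) s)
    · by_cases h : p = q' ∧ (d = c ∨ d = D.rank p)
      · exact exists_inter_of (.A d p (by grind) t)
      · exact exists_inter_of (.zero (max (D.rank p) d))
  | Tv d q hq =>
    by_cases h : p = q
    · subst h
      by_cases h : c = d
      · exact exists_inter_of (.Tv c p hp)
      · exact exists_inter_of (.A (D.rank p) p le_rfl true)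
    · exact exists_inter_of (.zero (max (D.rank p) (D.rank q)))
  | Tj d q k hq hk =>
    by_cases h : c ≤ k ∨ c = d ∧ p = q
    · exact exists_inter_of (.Tv c p hp)
    · by_cases h' : D.rank p ≤ k
      · exact exists_inter_of (.A (D.rank p) p le_rfl true)
      · exact exists_inter_of (.zero (D.rank p))

theorem Elt.exists_inter_Tj (c : C) (p : Q) (k : C) (hp : D.rank p ≤ k) (hk : k < c) (y : D.Elt) :
    ∃ z : D.Elt, z.gens = (Elt.Tj c p k hp hk : D.Elt).gens ∩ y.gens := by
  have e (d : C) (q : Q) (h : q = D.chain d) : D.rank q = d := rank_eq_of_eq_chain h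
  cases y with
  | zero d => exact exists_inter_comm (exists_inter_zero d _)
  | one d => exact exists_inter_comm (exists_inter_one d _)
  | W d n => exact exists_inter_comm (exists_inter_W d n _)
  | Tu d q hq => exact exists_inter_comm (exists_inter_Tu d q hq _)
  | Tv d q hq => exact exists_inter_comm (exists_inter_Tv d q hq _)
  | A d q hq s =>
    have := e d q
    by_cases h : d ≤ k ∨ d = c ∧ p = q
    · exact exists_inter_of (.A d q hq s)
    · exact exists_inter_of (.zero d)
  | H d p' q' hpq' hp' hq' s t hts =>
    have e4 := hpq'.ne
    have e2 := ne_chain_of_lt hq' hpq'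
    have := e d q'
    by_cases h : d ≤ k
    · exact exists_inter_of (.H d p' q' hpq' hp' hq' s t hts)
    · by_cases h : p = p' ∧ d = c
      · exact exists_inter_of (.A d p (by grind) s)
      · by_cases h : p = q' ∧ d = c
        · exact exists_inter_of (.A d p (by grind) t)
        · exact exists_inter_of (.zero d)
  | Tj d q m hq hm =>
    by_cases h : c = d ∧ p = q
    · exact exists_inter_of (.Tj c p (min k m) (by grind) (by grind))
    · by_cases h1 : c ≤ m
      · exact exists_inter_of (.Tj c p k hp hk)
      · by_cases h2 : d ≤ k
        · exact exists_inter_of (.Tj d q m hq hm)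
        · exact exists_inter_of (.one (min k m))

theorem Elt.exists_inter (x y : D.Elt) : ∃ z : D.Elt, z.gens = x.gens ∩ y.gens := by
  cases x with
  | zero d => exact exists_inter_zero d _
  | one d => exact exists_inter_one d _
  | W d n => exact exists_inter_W d n _
  | Tu d q hq => exact exists_inter_Tu d q hq _
  | Tv d q hq => exact exists_inter_Tv d q hq _
  | Tj d q k hq hk => exact exists_inter_Tj d q k hq hk _
  | A c p hp s =>
    cases y with
    | zero d => exact exists_inter_comm (exists_inter_zero d _)
    | one d => exact exists_inter_comm (exists_inter_one d _)
    | W d n => exact exists_inter_comm (exists_inter_W d n _)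
    | Tu d q hq => exact exists_inter_comm (exists_inter_Tu d q hq _)
    | Tv d q hq => exact exists_inter_comm (exists_inter_Tv d q hq _)
    | Tj d q k hq hk => exact exists_inter_comm (exists_inter_Tj d q k hq hk _)
    | A => apply exists_inter_A_A
    | H => apply exists_inter_A_H
  | H c p q hpq hp hq s t hts =>
    cases y with
    | zero d => exact exists_inter_comm (exists_inter_zero d _)
    | one d => exact exists_inter_comm (exists_inter_one d _)
    | W d n => exact exists_inter_comm (exists_inter_W d n _)
    | Tu d q hq => exact exists_inter_comm (exists_inter_Tu d q hq _)
    | Tv d q hq => exact exists_inter_comm (exists_inter_Tv d q hq _)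
    | Tj d q k hq hk => exact exists_inter_comm (exists_inter_Tj d q k hq hk _)
    | A => exact exists_inter_comm (by apply exists_inter_A_H)
    | H => apply exists_inter_H_H

end CofinalTower

/-! ### A well-founded rank and the existence of joins -/

namespace CofinalTower
variable {Q C : Type u} [PartialOrder Q] [LinearOrder C] {D : CofinalTower Q C}

namespace Elt

/-- The level of an element. -/
def level : D.Elt → C
  | .zero c => c
  | .one c => c
  | .A c _ _ _ => c
  | .W c _ => c
  | .H c _ _ _ _ _ _ _ _ => c
  | .Tu c _ _ => c
  | .Tv c _ _ => c
  | .Tj c _ _ _ _ => c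

/-- The height of an element within its level, up to the position in the chain of elements `Tj`. -/
def height : D.Elt → ℕ
  | .zero _ => 0
  | .one _ => 6
  | .A _ _ _ s => s.toNat
  | .W _ _ => 0
  | .H _ _ _ _ _ _ s t _ => 2 + s.toNat + t.toNat
  | .Tu _ _ _ => 1
  | .Tv _ _ _ => 2
  | .Tj _ _ _ _ _ => 3

/-- The position of an element in the chain of elements `Tj`. -/
def position : D.Elt → C
  | .Tj _ _ k _ _ => k
  | x => x.level

/-- A rank function that is strictly monotone above the nonzero elements. -/
def lexRank (x : D.Elt) : C ×ₗ ℕ ×ₗ C := toLex (x.level, toLex (x.height, x.position))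

/-- The element is the zero of a level. -/
def IsZero (x : D.Elt) : Prop := ∃ c, x = .zero c

set_option maxHeartbeats 2000000 in
-- A few generators of `x` already restrict which names can lie above it. Zeros must be excluded: a
-- larger zero has a smaller level.
theorem lt_or_eq_of_gens_subset {x y : D.Elt} (hx : ¬ x.IsZero) (h : x.gens ⊆ y.gens) :
    x.level < y.level ∨ x.level = y.level ∧ (x.height < y.height ∨
      x.height = y.height ∧ (x.position < y.position ∨ x.gens = y.gens)) := by
  replace h : ∀ g, x.Has g → y.Has g := h
  cases x with
  | zero c => exact absurd ⟨c, rfl⟩ hx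
  | one c =>
    have h1 := h (.w c 1)
    have h2 := h (.w c 2)
    cases y <;> grind [Elt.Has, Elt.level, Elt.height, Elt.position]
  | A c p hp s =>
    have h1 := h (.a c p s)
    have h2 := h (.o c)
    cases s <;> cases y <;> grind [Elt.Has, Elt.level, Elt.height, Elt.position, Bool.toNat]
  | W c n =>
    have h1 := h (.w c n)
    have h2 := h (.o c)
    cases y <;> grind [Elt.Has, Elt.level, Elt.height, Elt.position]
  | H c p q hpq hp hq s t hts =>
    have h1 := h (.a c p s)
    have h2 := h (.a c q t)
    have h4 := h (.o c)
    have h3 := hpq.ne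
    have e1 : ¬ q < p := hpq.not_gt
    cases s <;> cases t <;> cases y <;>
      grind [Elt.Has, Elt.level, Elt.height, Elt.position, Bool.toNat]
  | Tu c p hp =>
    have h1 := h (.a c p false)
    have h2 := h (.a (D.rank p) p false)
    cases y <;> grind [Elt.Has, Elt.level, Elt.height, Elt.position]
  | Tv c p hp =>
    have h1 := h (.a c p true)
    have h2 := h (.a (D.rank p) p true)
    cases y <;> grind [Elt.Has, Elt.level, Elt.height, Elt.position]
  | Tj c p k hp hk =>
    have h1 := h (.w k 1)
    have h2 := h (.a c p false)
    have h3 := h (.w k 2)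
    cases y <;> grind [Elt.Has, Elt.level, Elt.height, Elt.position]

theorem lexRank_lt_or_gens_eq {x y : D.Elt} (hx : ¬ x.IsZero) (h : x.gens ⊆ y.gens) :
    x.lexRank < y.lexRank ∨ x.gens = y.gens := by
  have := lt_or_eq_of_gens_subset hx h
  simp only [lexRank, Prod.Lex.toLex_lt_toLex]
  tauto

theorem gens_subset_one {x : D.Elt} {c : C} (h : x.level ≤ c) :
    x.gens ⊆ (Elt.one c : D.Elt).gens := by
  change ∀ g, x.Has g → (Elt.one c : D.Elt).Has g
  rintro (i | ⟨i, r, b⟩ | ⟨i, n⟩) <;> cases x <;> grind [Elt.Has, Elt.level]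

theorem gens_zero_subset_of_has {c : C} {x : D.Elt} (h : x.Has (.o c)) :
    (Elt.zero c : D.Elt).gens ⊆ x.gens := by
  change ∀ g, (Elt.zero c : D.Elt).Has g → x.Has g
  rintro (i | ⟨i, r, b⟩ | ⟨i, n⟩) <;> cases x <;> grind [Elt.Has]

theorem isZero_of_gens_subset {x : D.Elt} {c : C} (h : x.gens ⊆ (Elt.zero c : D.Elt).gens) :
    x.IsZero := by
  replace h : ∀ g, x.Has g → (Elt.zero c : D.Elt).Has g := h
  cases x with
  | zero c => exact ⟨c, rfl⟩
  | one d => exact (h (.w d 1) le_rfl).elim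
  | A d p hp s => exact (h (.a d p s) ⟨rfl, rfl, id⟩).elim
  | W d n => exact (h (.w d n) ⟨rfl, rfl⟩).elim
  | H d p q hpq hp hq s t hts => exact (h (.a d p s) ⟨rfl, .inl ⟨rfl, id⟩⟩).elim
  | Tu d p hp => exact (h (.a d p false) ⟨.inl rfl, rfl, rfl⟩).elim
  | Tv d p hp => exact (h (.a d p false) ⟨.inl rfl, rfl⟩).elim
  | Tj d p k hp hk => exact (h (.w k 1) le_rfl).elim

/-- Intersecting an upper bound of minimal rank with any other upper bound gives an upper bound
again. It lies above the nonzero `x`, hence is nonzero, so minimality makes it equal to the first.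
-/
theorem exists_least_upper_of_not_isZero [WellFoundedLT C] {x : D.Elt} (hx : ¬ x.IsZero)
    (y : D.Elt) : ∃ z : D.Elt, x.gens ⊆ z.gens ∧ y.gens ⊆ z.gens ∧
      ∀ w : D.Elt, x.gens ⊆ w.gens → y.gens ⊆ w.gens → z.gens ⊆ w.gens := by
  obtain ⟨z, ⟨hz₁, hz₂⟩, hz⟩ := (InvImage.wf (lexRank (D := D)) wellFounded_lt).has_min
    {w : D.Elt | x.gens ⊆ w.gens ∧ y.gens ⊆ w.gens}
    ⟨.one (max x.level y.level), gens_subset_one (le_max_left _ _),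
      gens_subset_one (le_max_right _ _)⟩
  refine ⟨z, hz₁, hz₂, fun w hw₁ hw₂ => ?_⟩
  obtain ⟨v, hv⟩ := exists_inter z w
  have hxv : x.gens ⊆ v.gens := hv ▸ Set.subset_inter hz₁ hw₁
  have hv0 : ¬ v.IsZero := by
    rintro ⟨c, rfl⟩
    exact hx (isZero_of_gens_subset hxv)
  rcases lexRank_lt_or_gens_eq hv0 (hv ▸ Set.inter_subset_left : v.gens ⊆ z.gens) with h | h
  · exact absurd h (hz v ⟨hxv, hv ▸ Set.subset_inter hz₂ hw₂⟩)
  · rw [← h, hv]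
    exact Set.inter_subset_right

theorem exists_least_upper [WellFoundedLT C] (x y : D.Elt) :
    ∃ z : D.Elt, x.gens ⊆ z.gens ∧ y.gens ⊆ z.gens ∧
      ∀ w : D.Elt, x.gens ⊆ w.gens → y.gens ⊆ w.gens → z.gens ⊆ w.gens := by
  by_cases hx : x.IsZero
  · by_cases hy : y.IsZero
    · obtain ⟨c, rfl⟩ := hx
      obtain ⟨d, rfl⟩ := hy
      rcases le_total c d with h | h
      · exact ⟨.zero c, subset_rfl, gens_zero_subset_of_has h, fun w h _ => h⟩
      · exact ⟨.zero d, gens_zero_subset_of_has h, subset_rfl, fun w _ h => h⟩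
    · obtain ⟨z, h₁, h₂, h₃⟩ := exists_least_upper_of_not_isZero hy x
      exact ⟨z, h₂, h₁, fun w h h' => h₃ w h' h⟩
  · exact exists_least_upper_of_not_isZero hx y

end Elt

variable (D) in
/-- The lattice attached to a cofinal tower: the sets of generators below its elements. -/
def Lat : Type u := {S : Set (Gen Q C) // ∃ x : D.Elt, x.gens = S}

instance : PartialOrder D.Lat := inferInstanceAs (PartialOrder (Subtype _))

/-- The element with a given name. -/
def Elt.toLat (x : D.Elt) : D.Lat := ⟨x.gens, x, rfl⟩

theorem Lat.exists_name (x : D.Lat) : ∃ e : D.Elt, e.toLat = x :=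
  let ⟨e, he⟩ := x.2
  ⟨e, Subtype.ext he⟩

/-- The generator `g` lies below `x`. -/
def Lat.Has (x : D.Lat) (g : Gen Q C) : Prop := g ∈ x.1

variable [WellFoundedLT C]

theorem Lat.exists_isLUB (x y : D.Lat) :
    ∃ z : D.Lat, x ≤ z ∧ y ≤ z ∧ ∀ w, x ≤ w → y ≤ w → z ≤ w := by
  obtain ⟨x, rfl⟩ := x.exists_name
  obtain ⟨y, rfl⟩ := y.exists_name
  obtain ⟨z, h₁, h₂, h₃⟩ := Elt.exists_least_upper x y
  refine ⟨z.toLat, h₁, h₂, fun w => ?_⟩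
  obtain ⟨w, rfl⟩ := w.exists_name
  exact h₃ w

noncomputable instance : Lattice D.Lat where
  inf x y := ⟨x.1 ∩ y.1, by
    obtain ⟨x, rfl⟩ := x.exists_name
    obtain ⟨y, rfl⟩ := y.exists_name
    exact Elt.exists_inter x y⟩
  sup x y := (Lat.exists_isLUB x y).choose
  inf_le_left x y := Set.inter_subset_left
  inf_le_right x y := Set.inter_subset_right
  le_inf x y z h₁ h₂ := Set.subset_inter h₁ h₂
  le_sup_left x y := (Lat.exists_isLUB x y).choose_spec.1
  le_sup_right x y := (Lat.exists_isLUB x y).choose_spec.2.1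
  sup_le x y z := (Lat.exists_isLUB x y).choose_spec.2.2 z

end CofinalTower

/-! ### The candidate congruence of a color -/

namespace CofinalTower
variable {Q C : Type u} [PartialOrder Q] [LinearOrder C] {D : CofinalTower Q C}

variable (D) in
/-- The levels collapsed by the congruence of color `r`. -/
def Low (r : Q) (i : C) : Prop := D.chain i ≤ r

theorem Low.mono {r : Q} {i j : C} (hij : i ≤ j) (hj : D.Low r j) : D.Low r i :=
  (D.chain.monotone hij).trans hj

theorem Low.le_of_rank_le {r p : Q} {i : C} (hp : D.rank p ≤ i) (hi : D.Low r i) : p ≤ r :=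
  (le_chain_of_rank_le hp).trans hi

variable (D) in
/-- The generators neglected by the congruence of color `r`. -/
def Collapsed (r : Q) : Gen Q C → Prop
  | .o i => D.Low r i
  | .a i p s => D.Low r i ∨ s = true ∧ p ≤ r
  | .w i _ => D.Low r i

namespace Elt

theorem Has.o_level {x : D.Elt} {g : Gen Q C} (h : x.Has g) : x.Has (.o g.level) := by
  rcases g with i | ⟨i, p, s⟩ | ⟨i, n⟩ <;> cases x <;> grind [Elt.Has, Gen.level]

theorem Has.o_mono {x : D.Elt} {i j : C} (h : x.Has (.o i)) (hij : i ≤ j) : x.Has (.o j) := by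
  cases x <;> grind [Elt.Has]

theorem Has.a_false {x : D.Elt} {i : C} {p : Q} {s : Bool} (h : x.Has (.a i p s)) :
    x.Has (.a i p false) := by
  cases x <;> grind [Elt.Has]

theorem Has.of_w_one {x : D.Elt} {j k : C} (hk : x.Has (.w k 1)) (hj : x.Has (.o j)) (hjk : j < k)
    {g : Gen Q C} (hg : g.level ≤ k) : x.Has g := by
  rcases g with i | ⟨i, p, s⟩ | ⟨i, n⟩ <;> cases x <;> grind [Elt.Has, Gen.level]

/-- The low levels form an initial segment of `C` that may have no greatest element, so a congruence
class may have no greatest element either. This supplies a single level up to which one has to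
absorb in order to get above `y`. -/
theorem exists_bound_low (r : Q) (y : D.Elt) :
    (∃ k, D.Low r k ∧ ∀ g, y.Has g → D.Low r g.level → g.level ≤ k ∨ ∃ i, g = .o i ∧ k ≤ i) ∨
    (∃ k, ¬ D.Low r k ∧ y.Has (.w k 1)) ∨ ∀ g, y.Has g → ¬ D.Low r g.level := by
  by_cases hc : D.Low r y.level
  · refine .inl ⟨_, hc, fun g hg _ => ?_⟩
    rcases g with i | ⟨i, p, s⟩ | ⟨i, n⟩
    · exact (le_total i _).imp id fun h => ⟨i, rfl, h⟩
    · left; cases y <;> grind [Elt.Has, Gen.level, Elt.level]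
    · left; cases y <;> grind [Elt.Has, Gen.level, Elt.level]
  have hm (i j : C) (hij : i ≤ j) (hj : D.Low r j) : D.Low r i := hj.mono hij
  cases y with
  | zero c =>
    refine .inr (.inr ?_)
    rintro (i | ⟨i, p, s⟩ | ⟨i, n⟩) <;> grind [Elt.Has, Gen.level, Elt.level]
  | one c => exact .inr (.inl ⟨c, hc, le_rfl⟩)
  | A c p hp s =>
    refine .inr (.inr ?_)
    rintro (i | ⟨i, p, s⟩ | ⟨i, n⟩) <;> grind [Elt.Has, Gen.level, Elt.level]
  | W c n =>
    refine .inr (.inr ?_)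
    rintro (i | ⟨i, p, s⟩ | ⟨i, n⟩) <;> grind [Elt.Has, Gen.level, Elt.level]
  | H c p q hpq hp hq s t hts =>
    refine .inr (.inr ?_)
    rintro (i | ⟨i, p, s⟩ | ⟨i, n⟩) <;> grind [Elt.Has, Gen.level, Elt.level]
  | Tu c p hp =>
    by_cases h : D.Low r (D.rank p)
    · refine .inl ⟨_, h, ?_⟩
      rintro (i | ⟨i, p, s⟩ | ⟨i, n⟩) <;> grind [Elt.Has, Gen.level, Elt.level]
    · refine .inr (.inr ?_)
      rintro (i | ⟨i, p, s⟩ | ⟨i, n⟩) <;> grind [Elt.Has, Gen.level, Elt.level]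
  | Tv c p hp =>
    by_cases h : D.Low r (D.rank p)
    · refine .inl ⟨_, h, ?_⟩
      rintro (i | ⟨i, p, s⟩ | ⟨i, n⟩) <;> grind [Elt.Has, Gen.level, Elt.level]
    · refine .inr (.inr ?_)
      rintro (i | ⟨i, p, s⟩ | ⟨i, n⟩) <;> grind [Elt.Has, Gen.level, Elt.level]
  | Tj c p k hp hk =>
    by_cases h : D.Low r k
    · refine .inl ⟨_, h, ?_⟩
      rintro (i | ⟨i, p, s⟩ | ⟨i, n⟩) <;> grind [Elt.Has, Gen.level, Elt.level]
    · exact .inr (.inl ⟨k, h, le_rfl⟩)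

end Elt

namespace Lat

/-- The congruence of color `r` as a relation. -/
def Sim (r : Q) (x y : D.Lat) : Prop :=
  (∀ g, ¬ D.Collapsed r g → (x.Has g ↔ y.Has g)) ∧
  -- All low `o i` are neglected, yet reaching a low floor must be remembered. Otherwise a low zero
  -- would be identified with the zero of the least level that is not low, and that level would
  -- collapse.
  ((∃ i, D.Low r i ∧ x.Has (.o i)) ↔ ∃ i, D.Low r i ∧ y.Has (.o i))

/-- `e` lies above `w` and absorbs everything congruent to `w` in the color `r` that comes from
levels up to `k`. -/
structure Absorbs (r : Q) (k : C) (w e : D.Lat) : Prop where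
  le : w ≤ e
  sim : Sim r w e
  color : ∀ i p, p ≤ r → w.Has (.a i p false) → e.Has (.a i p true)
  low : D.Low r k → (∃ j, D.Low r j ∧ w.Has (.o j)) → ∀ g : Gen Q C, g.level ≤ k → e.Has g

theorem Sim.refl (r : Q) (x : D.Lat) : Sim r x x := ⟨fun _ _ => Iff.rfl, Iff.rfl⟩

theorem Sim.symm {r : Q} {x y : D.Lat} (h : Sim r x y) : Sim r y x :=
  ⟨fun g hg => (h.1 g hg).symm, h.2.symm⟩

theorem Sim.trans {r : Q} {x y z : D.Lat} (h : Sim r x y) (h' : Sim r y z) : Sim r x z :=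
  ⟨fun g hg => (h.1 g hg).trans (h'.1 g hg), h.2.trans h'.2⟩

theorem Sim.of_le_of_le {r : Q} {x y z : D.Lat} (h : Sim r x z) (hxy : x ≤ y) (hyz : y ≤ z) :
    Sim r x y :=
  ⟨fun g hg => ⟨fun hx => hxy hx, fun hy => (h.1 g hg).2 (hyz hy)⟩,
    fun ⟨i, hi, hx⟩ => ⟨i, hi, hxy hx⟩, fun ⟨i, hi, hy⟩ => h.2.2 ⟨i, hi, hyz hy⟩⟩

theorem Has.o_level {x : D.Lat} {g : Gen Q C} (h : x.Has g) : x.Has (.o g.level) := by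
  obtain ⟨x, rfl⟩ := x.exists_name
  exact Elt.Has.o_level h

theorem Has.o_mono {x : D.Lat} {i j : C} (h : x.Has (.o i)) (hij : i ≤ j) : x.Has (.o j) := by
  obtain ⟨x, rfl⟩ := x.exists_name
  exact Elt.Has.o_mono h hij

theorem Has.a_false {x : D.Lat} {i : C} {p : Q} {s : Bool} (h : x.Has (.a i p s)) :
    x.Has (.a i p false) := by
  obtain ⟨x, rfl⟩ := x.exists_name
  exact Elt.Has.a_false h

theorem Has.of_w_one {x : D.Lat} {j k : C} (hk : x.Has (.w k 1)) (hj : x.Has (.o j)) (hjk : j < k)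
    {g : Gen Q C} (hg : g.level ≤ k) : x.Has g := by
  obtain ⟨x, rfl⟩ := x.exists_name
  exact Elt.Has.of_w_one hk hj hjk hg

/-- An element congruent to `x` and above it lies below everything that absorbs an element
above `x`. -/
theorem Sim.exists_le_of_absorbs {r : Q} {x y : D.Lat} (h : Sim r x y) :
    ∃ k, ∀ w e, x ≤ w → Absorbs r k w e → y ≤ e := by
  have key (k : C) (hk : ∀ g, y.Has g → D.Low r g.level → (∃ i, D.Low r i ∧ x.Has (.o i)) →
      x.Has g ∨ D.Low r k ∧ (g.level ≤ k ∨ ∃ i, g = .o i ∧ k ≤ i)) :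
      ∀ w e, x ≤ w → Absorbs r k w e → y ≤ e := by
    intro w e hxw he g hg
    change y.Has g at hg
    change e.Has g
    by_cases hl : D.Low r g.level
    · have hx := h.2.2 ⟨_, hl, hg.o_level⟩
      obtain ⟨i, hi, hxi⟩ := hx
      rcases hk g hg hl ⟨i, hi, hxi⟩ with h | ⟨hlk, h | ⟨j, rfl, hj⟩⟩
      · exact he.le (hxw h)
      · exact he.low hlk ⟨i, hi, hxw hxi⟩ g h
      · exact (he.low hlk ⟨i, hi, hxw hxi⟩ (.o k) le_rfl).o_mono hj
    · by_cases hc : D.Collapsed r g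
      · rcases g with i | ⟨i, p, s⟩ | ⟨i, n⟩
        · exact absurd hc hl
        · obtain ⟨rfl, hp⟩ : s = true ∧ p ≤ r := hc.resolve_left hl
          refine he.color i p hp (hxw ((h.1 _ ?_).2 hg.a_false))
          rintro (h | h)
          · exact hl h
          · exact Bool.false_ne_true h.1
        · exact absurd hc hl
      · exact he.le (hxw ((h.1 g hc).2 hg))
  obtain ⟨y, rfl⟩ := y.exists_name
  rcases y.exists_bound_low r with ⟨k, hk, hy⟩ | ⟨k, hk, hy⟩ | hy
  · exact ⟨k, key k fun g hg hl _ => .inr ⟨hk, hy g hg hl⟩⟩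
  · refine ⟨k, key k fun g hg hl ⟨i, hi, hxi⟩ => .inl ?_⟩
    have hlt {j : C} (hj : D.Low r j) : j < k := lt_of_not_ge fun h => hk (hj.mono h)
    exact Has.of_w_one ((h.1 (.w k 1) hk).2 hy) hxi (hlt hi) (hlt hl).le
  -- Here `y` has no low generators, so any level will do.
  · exact ⟨D.rank r, key _ fun g hg hl _ => absurd hl (hy g hg)⟩

end Lat
end CofinalTower


/-! ### Transporting a collapse to another interval -/

section LatticeCon

variable {L : Type u} [Lattice L] {c : LatticeCon L}

theorem rel_of_mem_interval {x y w e : L} (h : c.r x y) (hxw : x ≤ w) (hwe : w ≤ e) (hey : e ≤ y) :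
    c.r w e := by
  have h₁ := c.inf (c.sup h (c.iseqv.refl w)) (c.iseqv.refl e)
  rwa [sup_eq_right.2 hxw, inf_eq_left.2 hwe, sup_eq_left.2 (hwe.trans hey), inf_eq_right.2 hey]
    at h₁

theorem rel_of_le_sup {x y w e : L} (h : c.r x y) (hxw : x ≤ w) (hwe : w ≤ e) (he : e ≤ w ⊔ y) :
    c.r w e := by
  have h₁ := c.sup (c.iseqv.refl w) h
  rw [sup_eq_left.2 hxw] at h₁
  exact rel_of_mem_interval h₁ le_rfl hwe he

theorem rel_of_inf_le {x y z w e : L} (h : c.r x y) (hw : x ⊓ z ≤ w) (hwe : w ≤ e) (hey : e ≤ y)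
    (hez : e ≤ z) : c.r w e :=
  rel_of_mem_interval (c.inf h (c.iseqv.refl z)) hw hwe (le_inf hey hez)

end LatticeCon

/-! ### Join inequalities of the gadgets -/

namespace CofinalTower
variable {Q C : Type u} [PartialOrder Q] [LinearOrder C] {D : CofinalTower Q C}

namespace Elt

theorem toLat_le {x y : D.Elt} (h : ∀ g, x.Has g → y.Has g) : x.toLat ≤ y.toLat := h

theorem zero_le {x : D.Elt} {c : C} (h : x.Has (.o c)) : (Elt.zero c).toLat ≤ x.toLat :=
  gens_zero_subset_of_has h

theorem le_one {x : D.Elt} {c : C} (h : x.level ≤ c) : x.toLat ≤ (Elt.one c).toLat :=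
  gens_subset_one h

variable [WellFoundedLT C]

theorem toLat_le_sup {x y z : D.Elt} (h : ∀ v : D.Elt, (∀ g, x.Has g → v.Has g) →
    (∀ g, y.Has g → v.Has g) → ∀ g, z.Has g → v.Has g) : z.toLat ≤ x.toLat ⊔ y.toLat := by
  obtain ⟨v, hv⟩ := Lat.exists_name (x.toLat ⊔ y.toLat)
  rw [← hv]
  exact h v (hv ▸ le_sup_left : x.toLat ≤ v.toLat) (hv ▸ le_sup_right : y.toLat ≤ v.toLat)

theorem inf_toLat_le {x y z : D.Elt} (h : ∀ g, x.Has g → y.Has g → z.Has g) :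
    x.toLat ⊓ y.toLat ≤ z.toLat := fun g hg => h g hg.1 hg.2

/-- With the next lemma this makes the interval from `Tu` to `Tv` perspective to both intervals of
color `p`, at levels `rank p` and `c`. -/
theorem Tv_le_Tu_sup_low {c : C} {p : Q} (hp : D.rank p < c) :
    (Tv c p hp).toLat ≤ (Tu c p hp).toLat ⊔ (A (D.rank p) p le_rfl true).toLat := by
  refine toLat_le_sup fun v h₁ h₂ => ?_
  have e₁ := h₁ (.a c p false)
  have e₂ := h₁ (.o (D.rank p))
  have e₃ := h₂ (.a (D.rank p) p true)
  have e₄ := h₂ (.w (D.rank p) 0)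
  rintro (i | ⟨i, r, b⟩ | ⟨i, n⟩) <;> cases v <;> grind [Elt.Has]

theorem Tv_le_Tu_sup_high {c : C} {p : Q} (hp : D.rank p < c) :
    (Tv c p hp).toLat ≤ (Tu c p hp).toLat ⊔ (A c p hp.le true).toLat := by
  refine toLat_le_sup fun v h₁ h₂ => ?_
  have e₁ := h₁ (.a (D.rank p) p false)
  have e₂ := h₁ (.o (D.rank p))
  have e₃ := h₂ (.a c p true)
  rintro (i | ⟨i, r, b⟩ | ⟨i, n⟩) <;> cases v <;> grind [Elt.Has]

/-- No element has `a c p false` and `a c q true` without `a c p true`: this is the combination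
omitted from `H`. -/
theorem H_le_H_sup {c : C} {p q : Q} (hpq : p < q) (hp : D.rank p ≤ c) (hq : D.rank q ≤ c)
    (s t : Bool) (hts : t = true → s = true) :
    (H c p q hpq hp hq true true (fun h => h)).toLat ≤
      (H c p q hpq hp hq s t hts).toLat ⊔ (A c q hq true).toLat := by
  refine toLat_le_sup fun v h₁ h₂ => ?_
  have e₁ := h₁ (.a c p false)
  have e₃ := h₂ (.a c q true)
  have e₄ := h₂ (.w c 0)
  have := hpq.ne
  have := hpq.not_gt
  rintro (i | ⟨i, r, b⟩ | ⟨i, n⟩) <;> cases v <;> grind [Elt.Has]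

theorem H_le_H_sup_left {c : C} {p q : Q} (hpq : p < q) (hp : D.rank p ≤ c) (hq : D.rank q ≤ c)
    (s t : Bool) (hts : t = true → s = true) :
    (H c p q hpq hp hq true t (fun _ => rfl)).toLat ≤
      (H c p q hpq hp hq s t hts).toLat ⊔ (A c p hp true).toLat := by
  refine toLat_le_sup fun v h₁ h₂ g hg => ?_
  by_cases h : g = .a c p true
  · subst h; exact h₂ _ ⟨rfl, rfl, id⟩
  · refine h₁ g ?_
    rcases g with i | ⟨i, r, b⟩ | ⟨i, n⟩ <;> grind [Elt.Has]

theorem one_le_W_sup_W {c : C} {n m : Fin 3} (h : n ≠ m) :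
    (one c : D.Elt).toLat ≤ (W c n).toLat ⊔ (W c m).toLat := by
  refine toLat_le_sup fun v h₁ h₂ => ?_
  have e₁ := h₁ (.w c n) ⟨rfl, rfl⟩
  have e₂ := h₂ (.w c m) ⟨rfl, rfl⟩
  rintro (i | ⟨i, r, b⟩ | ⟨i, n⟩) <;> cases v <;> grind [Elt.Has]

theorem one_le_W_sup_A {c : C} {n : Fin 3} {p : Q} (hp : D.rank p ≤ c) (s : Bool) (h : n ≠ 0) :
    (one c : D.Elt).toLat ≤ (W c n).toLat ⊔ (A c p hp s).toLat := by
  refine toLat_le_sup fun v h₁ h₂ => ?_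
  have e₁ := h₁ (.w c n) ⟨rfl, rfl⟩
  have e₂ := h₂ (.a c p s) ⟨rfl, rfl, id⟩
  rintro (i | ⟨i, r, b⟩ | ⟨i, n⟩) <;> cases v <;> grind [Elt.Has]

theorem one_le_W_sup_zero {c d : C} {n : Fin 3} (h : d < c) :
    (one c : D.Elt).toLat ≤ (W c n).toLat ⊔ (zero d).toLat := by
  refine toLat_le_sup fun v h₁ h₂ => ?_
  have e₁ := h₁ (.w c n) ⟨rfl, rfl⟩
  have e₂ := h₂ (.o d) le_rfl
  rintro (i | ⟨i, r, b⟩ | ⟨i, n⟩) <;> cases v <;> grind [Elt.Has]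

theorem Tj_le_sup_one {c : C} {p : Q} {k : C} (hk : D.rank p ≤ k) (hkc : k < c) {x : D.Elt}
    (hx : x.Has (.a c p false)) :
    (Tj c p k hk hkc).toLat ≤ x.toLat ⊔ (one k).toLat := by
  refine toLat_le_sup fun v h₁ h₂ => ?_
  have e₁ := h₁ _ hx
  have e₂ := h₂ (.w k 1) le_rfl
  have e₃ := h₂ (.w k 2) le_rfl
  have e₄ := h₂ (.o (D.rank p)) trivial
  have e₅ := h₂ (.a (D.rank p) p true) hk
  rintro (i | ⟨i, r, b⟩ | ⟨i, n⟩) <;> cases v <;> grind [Elt.Has]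

end Elt
end CofinalTower

/-! ### Spreading of collapses, and absorbing elements -/

namespace CofinalTower
variable {Q C : Type u} [PartialOrder Q] [LinearOrder C] {D : CofinalTower Q C}
open Elt

theorem A_false_le_true {c : C} {p : Q} (hp : D.rank p ≤ c) :
    (A c p hp false).toLat ≤ (A c p hp true).toLat := by
  refine toLat_le ?_
  rintro (i | ⟨i, r, b⟩ | ⟨i, n⟩) <;> grind [Elt.Has]

theorem Tu_le_Tv {c : C} {p : Q} (hp : D.rank p < c) :
    (Tu c p hp).toLat ≤ (Tv c p hp).toLat := by
  refine toLat_le ?_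
  rintro (i | ⟨i, r, b⟩ | ⟨i, n⟩) <;> grind [Elt.Has]

theorem H_mono {c : C} {p q : Q} (hpq : p < q) (hp : D.rank p ≤ c) (hq : D.rank q ≤ c)
    {s t s' t' : Bool} (h : t = true → s = true) (h' : t' = true → s' = true) (hs : s = true → s' = true)
    (ht : t = true → t' = true) :
    (H c p q hpq hp hq s t h).toLat ≤ (H c p q hpq hp hq s' t' h').toLat := by
  refine toLat_le ?_
  rintro (i | ⟨i, r, b⟩ | ⟨i, n⟩) <;> grind [Elt.Has]

theorem Elt.has_o_level (x : D.Elt) : x.Has (.o x.level) := by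
  cases x <;> grind [Elt.Has, Elt.level]

theorem Lat.Absorbs.of_names {r : Q} {k : C} {w e : D.Elt} (hle : ∀ g, w.Has g → e.Has g)
    (hc : ∀ g, e.Has g → ¬ D.Collapsed r g → w.Has g)
    (ho : ∀ i, D.Low r i → e.Has (.o i) → ∃ j, D.Low r j ∧ w.Has (.o j))
    (color : ∀ i p, p ≤ r → w.Has (.a i p false) → e.Has (.a i p true))
    (low : D.Low r k → ∀ j, D.Low r j → w.Has (.o j) → ∀ g : Gen Q C, g.level ≤ k → e.Has g) :
    Lat.Absorbs r k w.toLat e.toLat where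
  le := hle
  sim := ⟨fun g hg => ⟨fun h => hle g h, fun h => hc g h hg⟩,
    fun ⟨i, hi, h⟩ => ⟨i, hi, hle _ h⟩, fun ⟨i, hi, h⟩ => ho i hi h⟩
  color := color
  low hk := fun ⟨j, hj, h⟩ => low hk j hj h

theorem exists_tail_index {r : Q} (k : C) {c d : C} (hc : ¬ D.Low r c) (h : D.Low r d) :
    ∃ m, d ≤ m ∧ m < c ∧ D.Low r m ∧ (D.Low r k → k ≤ m) := by
  by_cases hk : D.Low r k
  · rcases le_total d k with h' | h'
    · exact ⟨k, h', lt_of_not_ge fun h => hc (hk.mono h), hk, fun _ => le_rfl⟩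
    · exact ⟨_, le_rfl, lt_of_not_ge fun h' => hc (h.mono h'), h, fun _ => h'⟩
  · exact ⟨_, le_rfl, lt_of_not_ge fun h' => hc (h.mono h'), h, fun h => absurd h hk⟩

variable [WellFoundedLT C] {θ : LatticeCon D.Lat}

/-- The congruence collapses the interval of color `p` at level `c`. -/
def Collapses (θ : LatticeCon D.Lat) (c : C) (p : Q) (hp : D.rank p ≤ c) : Prop :=
  θ.r (A c p hp false).toLat (A c p hp true).toLat

theorem rel_Tu_Tv_of_low {c : C} {p : Q} (hp : D.rank p < c) (h : Collapses θ (D.rank p) p le_rfl) :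
    θ.r (Tu c p hp).toLat (Tv c p hp).toLat := by
  refine rel_of_le_sup h (toLat_le ?_) (Tu_le_Tv hp) (Tv_le_Tu_sup_low hp)
  rintro (i | ⟨i, r, b⟩ | ⟨i, n⟩) <;> grind [Elt.Has]

theorem rel_Tu_Tv_of_high {c : C} {p : Q} (hp : D.rank p < c) (h : Collapses θ c p hp.le) :
    θ.r (Tu c p hp).toLat (Tv c p hp).toLat := by
  refine rel_of_le_sup h (toLat_le ?_) (Tu_le_Tv hp) (Tv_le_Tu_sup_high hp)
  rintro (i | ⟨i, r, b⟩ | ⟨i, n⟩) <;> grind [Elt.Has]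

theorem collapses_of_rel_Tu_Tv {c : C} {p : Q} (hp : D.rank p < c)
    (h : θ.r (Tu c p hp).toLat (Tv c p hp).toLat) :
    Collapses θ c p hp.le ∧ Collapses θ (D.rank p) p le_rfl := by
  have e (h : p = D.chain c) : D.rank p = c := rank_eq_of_eq_chain h
  constructor <;> refine rel_of_inf_le (z := (A _ p _ true).toLat) h (inf_toLat_le ?_)
    (A_false_le_true _) (toLat_le ?_) le_rfl <;>
    rintro (i | ⟨i, r, b⟩ | ⟨i, n⟩) <;> grind [Elt.Has]

/-- Every level is linked only to level `rank p`, so the transfer goes down to it and up again. -/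
theorem Collapses.change_level {c d : C} {p : Q} {hp : D.rank p ≤ c} (h : Collapses θ c p hp)
    (hd : D.rank p ≤ d) : Collapses θ d p hd := by
  have low : Collapses θ (D.rank p) p le_rfl := by
    rcases hp.eq_or_lt with rfl | hlt
    · exact h
    · exact (collapses_of_rel_Tu_Tv hlt (rel_Tu_Tv_of_high hlt h)).2
  rcases hd.eq_or_lt with rfl | hlt
  · exact low
  · exact (collapses_of_rel_Tu_Tv hlt (rel_Tu_Tv_of_low hlt low)).1

theorem Collapses.rel_H {c : C} {p q : Q} (hpq : p < q) (hp : D.rank p ≤ c) {hq : D.rank q ≤ c}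
    (h : Collapses θ c q hq) {s t : Bool} (hts : t = true → s = true) :
    θ.r (H c p q hpq hp hq s t hts).toLat (H c p q hpq hp hq true true fun h => h).toLat := by
  refine rel_of_le_sup h (toLat_le ?_) (H_mono _ _ _ _ _ (fun _ => rfl) (fun _ => rfl))
    (H_le_H_sup ..)
  rintro (i | ⟨i, r, b⟩ | ⟨i, n⟩) <;> grind [Elt.Has]

theorem Collapses.rel_H_left {c : C} {p q : Q} (hpq : p < q) {hp : D.rank p ≤ c}
    (hq : D.rank q ≤ c) (h : Collapses θ c p hp) {s t : Bool} (hts : t = true → s = true) :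
    θ.r (H c p q hpq hp hq s t hts).toLat (H c p q hpq hp hq true t fun _ => rfl).toLat := by
  have := ne_chain_of_lt hq hpq
  refine rel_of_le_sup h (toLat_le ?_) (H_mono _ _ _ _ _ (fun _ => rfl) id)
    (H_le_H_sup_left ..)
  rintro (i | ⟨i, r, b⟩ | ⟨i, n⟩) <;> grind [Elt.Has]

theorem Collapses.of_lt_same_level {c : C} {p q : Q} (hpq : p < q) (hp : D.rank p ≤ c)
    {hq : D.rank q ≤ c} (h : Collapses θ c q hq) : Collapses θ c p hp := by
  have e₁ := ne_chain_of_lt hq hpq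
  have e₂ := hpq.ne
  refine rel_of_inf_le (z := (A _ p hp true).toLat)
    (h.rel_H hpq hp (s := false) (t := false) (fun h => h)) (inf_toLat_le ?_)
    (A_false_le_true _) (toLat_le ?_) le_rfl <;>
  rintro (i | ⟨i, r, b⟩ | ⟨i, n⟩) <;> grind [Elt.Has]

theorem Collapses.of_le {c d : C} {p q : Q} (hpq : p ≤ q) {hq : D.rank q ≤ c}
    (h : Collapses θ c q hq) (hp : D.rank p ≤ d) : Collapses θ d p hp := by
  rcases hpq.eq_or_lt with rfl | hlt
  · exact h.change_level hp
  -- The gadget `H` for `p < q` needs a level above both ranks, and `rank` need not be monotone.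
  · exact ((h.change_level (le_max_right (D.rank p) (D.rank q))).of_lt_same_level hlt
      (le_max_left _ _)).change_level hp

/-- This is the simplicity argument for a diamond: joining with `W c n` and `W c m` identifies each
with `one c`, and meeting the two identifies `W c m` with `zero c` as well. -/
theorem rel_zero_one {c : C} {x : D.Elt} (h : θ.r (zero c).toLat x.toLat) {n m : Fin 3}
    (hnm : n ≠ m) (hn : (one c : D.Elt).toLat ≤ (W c n).toLat ⊔ x.toLat)
    (hm : (one c : D.Elt).toLat ≤ (W c m).toLat ⊔ x.toLat) :
    θ.r (zero c : D.Elt).toLat (one c : D.Elt).toLat := by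
  have key (n : Fin 3) (hn : (one c : D.Elt).toLat ≤ (W c n).toLat ⊔ x.toLat) :
      θ.r (W c n : D.Elt).toLat (one c : D.Elt).toLat :=
    rel_of_le_sup h (zero_le le_rfl) (le_one le_rfl) hn
  refine θ.iseqv.trans (rel_of_inf_le (z := (W c m : D.Elt).toLat) (key n hn) (inf_toLat_le ?_)
    (zero_le le_rfl) (le_one le_rfl) le_rfl) (key m hm)
  rintro (i | ⟨i, r, b⟩ | ⟨i, k⟩) <;> grind [Elt.Has]

theorem Collapses.rel_zero_one {c d : C} {r : Q} {hr : D.rank r ≤ d} (h : Collapses θ d r hr)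
    (hc : D.Low r c) : θ.r (zero c : D.Elt).toLat (one c : D.Elt).toLat := by
  have h₁ : Collapses θ c (D.chain c) (D.rank_chain c).le := h.of_le hc _
  -- `W c 0` lies below `A c (chain c) true` and meets `A c (chain c) false` in `zero c`.
  have h₂ : θ.r (zero c : D.Elt).toLat (W c 0 : D.Elt).toLat := by
    refine rel_of_inf_le (z := (W c 0 : D.Elt).toLat) h₁ (inf_toLat_le ?_) (zero_le le_rfl)
      (toLat_le ?_) le_rfl <;>
    rintro (i | ⟨i, r, b⟩ | ⟨i, k⟩) <;> grind [Elt.Has]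
  exact CofinalTower.rel_zero_one h₂ (n := 1) (m := 2) (by decide)
    (one_le_W_sup_W (by decide)) (one_le_W_sup_W (by decide))

theorem collapses_of_rel_zero_one {c : C} (h : θ.r (zero c : D.Elt).toLat (one c : D.Elt).toLat) :
    Collapses θ c (D.chain c) (D.rank_chain c).le :=
  rel_of_mem_interval h (zero_le le_rfl) (A_false_le_true _) (le_one le_rfl)

/-- `θ` collapses the color `r`. -/
def CollapsesColor (θ : LatticeCon D.Lat) (r : Q) : Prop := Collapses θ (D.rank r) r le_rfl

theorem CollapsesColor.collapses {r p : Q} (h : CollapsesColor θ r) (hp : p ≤ r) {c : C}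
    (hc : D.rank p ≤ c) : Collapses θ c p hc := Collapses.of_le hp h hc

theorem CollapsesColor.rel_zero_one {r : Q} (h : CollapsesColor θ r) {c : C} (hc : D.Low r c) :
    θ.r (zero c : D.Elt).toLat (one c : D.Elt).toLat := Collapses.rel_zero_one h hc

theorem Lat.Absorbs.self {r : Q} {k : C} {w : D.Elt}
    (color : ∀ i p, p ≤ r → w.Has (.a i p false) → w.Has (.a i p true))
    (low : D.Low r k → ∀ j, D.Low r j → w.Has (.o j) → ∀ g : Gen Q C, g.level ≤ k → w.Has g) :
    ∃ e, Lat.Absorbs r k w.toLat e ∧ ∀ θ : LatticeCon D.Lat, CollapsesColor θ r → θ.r w.toLat e :=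
  ⟨_, .of_names (fun _ h => h) (fun _ h _ => h) (fun i hi h => ⟨i, hi, h⟩) color low,
    fun θ _ => θ.iseqv.refl _⟩

/-- All of a low level collapses, so `w` can be raised to `one m` for a low `m` above its own level
and, when `k` is low, above `k`. -/
theorem exists_absorbs_of_low {r : Q} (k : C) {w : D.Elt} (hw : D.Low r w.level) :
    ∃ e, Lat.Absorbs r k w.toLat e ∧
      ∀ θ : LatticeCon D.Lat, CollapsesColor θ r → θ.r w.toLat e := by
  obtain ⟨m, hm, hwm, hkm⟩ : ∃ m, D.Low r m ∧ w.level ≤ m ∧ (D.Low r k → k ≤ m) := by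
    by_cases hk : D.Low r k
    · rcases le_total w.level k with h | h
      · exact ⟨k, hk, h, fun _ => le_rfl⟩
      · exact ⟨w.level, hw, le_rfl, fun _ => h⟩
    · exact ⟨w.level, hw, le_rfl, fun h => absurd h hk⟩
  have hgen (g : Gen Q C) (hg : g.level ≤ m) : (one m : D.Elt).Has g := by
    rcases g with i | ⟨i, p, s⟩ | ⟨i, n⟩
    exacts [trivial, hg, hg]
  refine ⟨(one m).toLat, .of_names (le_one hwm) ?_ ?_ ?_ ?_, fun θ hθ => ?_⟩
  · rintro (i | ⟨i, p, s⟩ | ⟨i, n⟩) hg hc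
    · exact w.has_o_level.o_mono (le_of_not_ge fun h => hc (hw.mono h))
    · exact absurd (.inl (hm.mono hg)) hc
    · exact absurd (hm.mono hg) hc
  · exact fun i _ _ => ⟨_, hw, w.has_o_level⟩
  · exact fun i p _ hw => le_one hwm hw
  · exact fun hk j _ _ g hg => hgen g (hg.trans (hkm hk))
  · exact rel_of_mem_interval (hθ.rel_zero_one hm) (zero_le (w.has_o_level.o_mono hwm))
      (le_one hwm) le_rfl

/-- Above the low level `m` only the tail at level `c` survives; joining with `one m` raises `w` to
`Tj c p m`, and `zero m` and `one m` are identified. -/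
theorem exists_absorbs_of_tail {r : Q} (k : C) {c : C} {p : Q} {w : D.Elt} {m : C}
    (hm : D.rank p ≤ m) (hmc : m < c) (hr : D.Low r m) (hkm : D.Low r k → k ≤ m)
    (hw : ∀ g, w.Has g → (Tj c p m hm hmc).Has g)
    (ha : w.Has (.a c p false)) (ho : w.Has (.o (D.rank p))) :
    ∃ e, Lat.Absorbs r k w.toLat e ∧
      ∀ θ : LatticeCon D.Lat, CollapsesColor θ r → θ.r w.toLat e := by
  have hpr := hr.le_of_rank_le hm
  refine ⟨(Tj c p m hm hmc).toLat, .of_names hw ?_ ?_ ?_ ?_, fun θ hθ => ?_⟩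
  · rintro (i | ⟨i, q, s⟩ | ⟨i, n⟩) hg hc
    · exact ho.o_mono (hm.trans (le_of_not_ge fun h => hc (hr.mono h)))
    · rcases hg with h | ⟨rfl, rfl⟩
      · exact absurd (.inl (hr.mono h)) hc
      · cases s
        · exact ha
        · exact absurd (.inr ⟨rfl, hpr⟩) hc
    · exact absurd (hr.mono hg) hc
  · exact fun _ _ _ => ⟨_, hr.mono hm, ho⟩
  · exact fun i q _ h => hw (.a i q false) h
  · rintro hk j _ _ (i | ⟨i, q, s⟩ | ⟨i, n⟩) hg
    exacts [trivial, .inl (hg.trans (hkm hk)), hg.trans (hkm hk)]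
  · exact rel_of_le_sup (hθ.rel_zero_one hr) (zero_le (ho.o_mono hm)) hw (Tj_le_sup_one hm hmc ha)

/-- Each name is raised by the gadget it belongs to: `A` and `H` get their marks of colors below
`r`, `Tu` becomes `Tv` or, over a low level, a `Tj`. The same `e` for all `θ` serves both the join
property of `Sim` and its minimality. -/
theorem exists_absorbs (r : Q) (k : C) (w : D.Lat) : ∃ e, Lat.Absorbs r k w e ∧
    ∀ θ : LatticeCon D.Lat, CollapsesColor θ r → θ.r w e := by
  obtain ⟨w, rfl⟩ := w.exists_name
  by_cases hw : D.Low r w.level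
  · exact exists_absorbs_of_low k hw
  have hmono (i j : C) (hij : i ≤ j) (hj : D.Low r j) : D.Low r i := hj.mono hij
  have hpr (p : Q) (i : C) (h : D.rank p ≤ i) (h' : D.Low r i) : p ≤ r := h'.le_of_rank_le h
  have hch (i : C) : D.Low r i ↔ D.chain i ≤ r := Iff.rfl
  cases w with
  | zero c => exact Lat.Absorbs.self (fun _ _ _ h => h.elim) fun hk j hj h => absurd (hj.mono h) hw
  | one c =>
    refine Lat.Absorbs.self (fun _ _ _ h => h) fun hk j hj h => ?_
    have : k ≤ c := le_of_not_ge fun h => hw (hk.mono h)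
    rintro (i | ⟨i, p, s⟩ | ⟨i, n⟩) hg
    exacts [trivial, hg.trans this, hg.trans this]
  | W c n => exact Lat.Absorbs.self (fun _ _ _ h => h.elim) fun hk j hj h => absurd (hj.mono h) hw
  | A c p hp s =>
    by_cases h : p ≤ r
    · refine ⟨(A c p hp true).toLat, .of_names ?_ ?_ ?_ ?_ ?_, fun θ hθ => ?_⟩
      · rintro (i | ⟨i, q, s⟩ | ⟨i, n⟩) <;> grind [Elt.Has]
      · rintro (i | ⟨i, q, s⟩ | ⟨i, n⟩) <;> grind [Elt.Has, Collapsed, Elt.level]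
      · exact fun i hi h => ⟨i, hi, h⟩
      · rintro i q hq ⟨h₁, h₂, h₃⟩
        exact ⟨h₁, h₂, fun _ => rfl⟩
      · exact fun hk j hj h => absurd (hj.mono h) hw
      · cases s
        · exact hθ.collapses h hp
        · exact θ.iseqv.refl _
    · exact Lat.Absorbs.self (fun i q hq h' => absurd (h'.2.1 ▸ hq) h) fun hk j hj h => absurd (hj.mono h) hw
  | H c p q hpq hp hq s t hts =>
    by_cases h : q ≤ r
    · refine ⟨(H c p q hpq hp hq true true id).toLat, .of_names ?_ ?_ ?_ ?_ ?_,
        fun θ hθ => (hθ.collapses h hq).rel_H hpq hp hts⟩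
      · rintro (i | ⟨i, q, s⟩ | ⟨i, n⟩) <;> grind [Elt.Has]
      · have := hpq.le.trans h
        rintro (i | ⟨i, q, s⟩ | ⟨i, n⟩) <;> grind [Elt.Has, Collapsed, Elt.level]
      · exact fun i hi h => ⟨i, hi, h⟩
      · intro i q'
        grind [Elt.Has]
      · exact fun hk j hj h => absurd (hj.mono h) hw
    · by_cases h' : p ≤ r
      · refine ⟨(H c p q hpq hp hq true t fun _ => rfl).toLat, .of_names ?_ ?_ ?_ ?_ ?_,
          fun θ hθ => (hθ.collapses h' hp).rel_H_left hpq hq hts⟩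
        · rintro (i | ⟨i, q, s⟩ | ⟨i, n⟩) <;> grind [Elt.Has]
        · rintro (i | ⟨i, q, s⟩ | ⟨i, n⟩) <;> grind [Elt.Has, Collapsed, Elt.level]
        · exact fun i hi h => ⟨i, hi, h⟩
        · intro i q'
          grind [Elt.Has]
        · exact fun hk j hj h => absurd (hj.mono h) hw
      · refine Lat.Absorbs.self (fun i q' => ?_) fun hk j hj h => absurd (hj.mono h) hw
        grind [Elt.Has]
  | Tu c p hp =>
    by_cases h : D.Low r (D.rank p)
    · obtain ⟨m, h₁, h₂, h₃, h₄⟩ := exists_tail_index k hw h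
      refine exists_absorbs_of_tail k h₁ h₂ h₃ h₄ ?_ ⟨.inl rfl, rfl, rfl⟩ le_rfl
      clear hmono hpr hch
      rintro (i | ⟨i, q, s⟩ | ⟨i, n⟩) <;> grind [Elt.Has, Elt.level]
    · by_cases h' : p ≤ r
      · refine ⟨(Tv c p hp).toLat, .of_names ?_ ?_ ?_ ?_ ?_,
          fun θ hθ => rel_Tu_Tv_of_low hp (hθ.collapses h' le_rfl)⟩
        · rintro (i | ⟨i, q, s⟩ | ⟨i, n⟩) <;> grind [Elt.Has]
        · rintro (i | ⟨i, q, s⟩ | ⟨i, n⟩) <;> grind [Elt.Has, Collapsed, Elt.level]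
        · exact fun i hi h => ⟨i, hi, h⟩
        · intro i q'
          grind [Elt.Has]
        · exact fun hk j hj h' => absurd (hj.mono h') h
      · refine Lat.Absorbs.self (fun i q' => ?_) fun hk j hj h' => absurd (hj.mono h') h
        grind [Elt.Has]
  | Tv c p hp =>
    by_cases h : D.Low r (D.rank p)
    · obtain ⟨m, h₁, h₂, h₃, h₄⟩ := exists_tail_index k hw h
      refine exists_absorbs_of_tail k h₁ h₂ h₃ h₄ ?_ ⟨.inl rfl, rfl⟩ le_rfl
      clear hmono hpr hch
      rintro (i | ⟨i, q, s⟩ | ⟨i, n⟩) <;> grind [Elt.Has, Elt.level]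
    · exact Lat.Absorbs.self (fun i q' hq h' => h') fun hk j hj h' => absurd (hj.mono h') h
  | Tj c p m hp hm =>
    -- Only when `k` is low and beyond `m` must the tail be lengthened; otherwise it already
    -- contains every generator up to `k`.
    by_cases hk : D.Low r k ∧ m < k
    · refine exists_absorbs_of_tail k (hp.trans hk.2.le)
        (lt_of_not_ge fun h => hw (hk.1.mono h)) hk.1 (fun _ => le_rfl) ?_ (.inr ⟨rfl, rfl⟩) trivial
      clear hmono hpr hch
      rintro (i | ⟨i, q, s⟩ | ⟨i, n⟩) <;> grind [Elt.Has, Elt.level]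
    · refine Lat.Absorbs.self (fun i q' hq h' => h') fun h j _ _ => ?_
      have : k ≤ m := le_of_not_gt fun h' => hk ⟨h, h'⟩
      rintro (i | ⟨i, q, s⟩ | ⟨i, n⟩) hg
      exacts [trivial, .inl (hg.trans this), hg.trans this]

end CofinalTower

/-! ### The congruence of a color and its minimality -/

namespace CofinalTower
variable {Q C : Type u} [PartialOrder Q] [LinearOrder C] {D : CofinalTower Q C}

open Elt

namespace Elt

theorem Has.a_true_of_w {x : D.Elt} {d : C} {p : Q} (h : x.Has (.a d p false))
    (hw : x.Has (.w d 0)) (hp : p = D.chain d) : x.Has (.a d p true) := by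
  have := rank_eq_of_eq_chain hp
  cases x <;> grind [Elt.Has]

theorem Has.w_of_a_true {x : D.Elt} {d : C} {p : Q} (h : x.Has (.a d p true))
    (hp : p = D.chain d) : x.Has (.w d 0) := by
  have := rank_eq_of_eq_chain hp
  cases x with
  | H c p' q hpq hp' hq s t hts =>
    have := ne_chain_of_lt hq hpq
    grind [Elt.Has]
  | _ => grind [Elt.Has]

theorem Has.a_true_of_lt {x : D.Elt} {d : C} {p q : Q} (hpq : p < q) (hp : x.Has (.a d p false))
    (hq : x.Has (.a d q true)) : x.Has (.a d p true) := by
  have := hpq.ne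
  have := hpq.not_gt
  cases x <;> grind [Elt.Has]

theorem Has.rank_of_lt {x : D.Elt} {d i : C} {p : Q} (h : x.Has (.a d p false)) (ho : x.Has (.o i))
    (hi : i < d) (hp : D.rank p ≤ d) : x.Has (.o (D.rank p)) ∧ x.Has (.a (D.rank p) p false) := by
  cases x <;> grind [Elt.Has]

theorem A_le_of_has {x : D.Elt} {d : C} {p : Q} (hp : D.rank p ≤ d) {s : Bool}
    (h : x.Has (.a d p s)) : (A d p hp s).toLat ≤ x.toLat := by
  refine toLat_le ?_
  rintro (i | ⟨i, q, b⟩ | ⟨i, n⟩) hg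
  · exact h.o_level.o_mono hg
  · obtain ⟨rfl, rfl, hb⟩ := hg
    cases b
    · exact h.a_false
    · rwa [hb rfl] at h
  · obtain ⟨rfl, h₁, rfl, rfl⟩ := hg
    exact h.w_of_a_true h₁

theorem W_le_of_has {x : D.Elt} {d : C} {n : Fin 3} (h : x.Has (.w d n)) :
    (W d n).toLat ≤ x.toLat := by
  refine toLat_le ?_
  rintro (i | ⟨i, q, b⟩ | ⟨i, n⟩) hg
  · exact h.o_level.o_mono hg
  · exact hg.elim
  · obtain ⟨rfl, rfl⟩ := hg
    exact h

theorem Tu_le_of_has {x : D.Elt} {d : C} {p : Q} (hp : D.rank p < d) (h : x.Has (.a d p false))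
    (ho : x.Has (.o (D.rank p))) : (Tu d p hp).toLat ≤ x.toLat := by
  refine toLat_le ?_
  rintro (i | ⟨i, q, b⟩ | ⟨i, n⟩) hg
  · exact ho.o_mono hg
  · obtain ⟨rfl | rfl, rfl, rfl⟩ := hg
    · exact h
    · exact (h.rank_of_lt ho hp hp.le).2
  · exact hg.elim

theorem Tj_le_of_has {x : D.Elt} {d : C} {p : Q} {k : C} (hp : D.rank p ≤ k) (hk : k < d)
    (h : x.Has (.a d p false)) (ho : x.Has (.o (D.rank p))) (hw : x.Has (.w k 1)) :
    (Tj d p k hp hk).toLat ≤ x.toLat := by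
  refine toLat_le ?_
  rintro (i | ⟨i, q, b⟩ | ⟨i, n⟩) <;> cases x <;> grind [Elt.Has]

theorem exists_zero_index (x : D.Elt) (d : C) :
    ∃ c, d ≤ c ∧ ∀ i, d ≤ i → (x.Has (.o i) ↔ c ≤ i) := by
  cases x with
  | zero c => exact ⟨max c d, le_max_right _ _, by grind [Elt.Has]⟩
  | one c => exact ⟨d, le_rfl, by grind [Elt.Has]⟩
  | A c p hp s => exact ⟨max c d, le_max_right _ _, by grind [Elt.Has]⟩
  | W c n => exact ⟨max c d, le_max_right _ _, by grind [Elt.Has]⟩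
  | H c p q hpq hp hq s t hts => exact ⟨max c d, le_max_right _ _, by grind [Elt.Has]⟩
  | Tu c p hp => exact ⟨max (D.rank p) d, le_max_right _ _, by grind [Elt.Has]⟩
  | Tv c p hp => exact ⟨max (D.rank p) d, le_max_right _ _, by grind [Elt.Has]⟩
  | Tj c p k hp hk => exact ⟨d, le_rfl, by grind [Elt.Has]⟩

theorem one_le_of_has {x : D.Elt} {d : C} (h₁ : x.Has (.w d 1)) (h₂ : x.Has (.w d 2)) :
    (one d).toLat ≤ x.toLat := by
  refine toLat_le ?_
  rintro (i | ⟨i, q, b⟩ | ⟨i, n⟩) <;> cases x <;> grind [Elt.Has]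

end Elt

variable [WellFoundedLT C]

theorem Lat.Sim.inf {r : Q} {w x y z : D.Lat} (h : Sim r w x) (h' : Sim r y z) :
    Sim r (w ⊓ y) (x ⊓ z) := by
  refine ⟨fun g hg => and_congr (h.1 g hg) (h'.1 g hg), ?_⟩
  have key (a b : D.Lat) : (∃ i, D.Low r i ∧ (a ⊓ b).Has (.o i)) ↔
      (∃ i, D.Low r i ∧ a.Has (.o i)) ∧ ∃ i, D.Low r i ∧ b.Has (.o i) := by
    refine ⟨fun ⟨i, hi, h⟩ => ⟨⟨i, hi, h.1⟩, i, hi, h.2⟩, fun ⟨⟨i, hi, h⟩, j, hj, h'⟩ => ?_⟩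
    rcases le_total i j with hij | hij
    · exact ⟨j, hj, h.o_mono hij, h'⟩
    · exact ⟨i, hi, h, h'.o_mono hij⟩
  rw [key, key, h.2, h'.2]

/-- For `a ≤ b` in one class, an absorber of `a ⊔ z` lies above both `b` and `z`, hence above `b ⊔
z`, and classes are convex. The general case passes through `x ⊓ y`. -/
theorem Lat.Sim.sup_right {r : Q} {x y : D.Lat} (h : Sim r x y) (z : D.Lat) :
    Sim r (x ⊔ z) (y ⊔ z) := by
  have key {a b : D.Lat} (hab : a ≤ b) (h : Sim r a b) : Sim r (a ⊔ z) (b ⊔ z) := by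
    obtain ⟨k, hk⟩ := h.exists_le_of_absorbs
    obtain ⟨e, he, -⟩ := exists_absorbs r k (a ⊔ z)
    exact he.sim.of_le_of_le (sup_le_sup_right hab z)
      (sup_le (hk _ e le_sup_left he) (le_sup_right.trans he.le))
  have h₁ := h.inf (Sim.refl r y)
  have h₂ := (Sim.refl r x).inf h
  rw [inf_idem] at h₁ h₂
  exact (key inf_le_left h₂.symm).symm.trans (key inf_le_right h₁)

variable (D) in
/-- The congruence of color `r`. -/
def colorCon (r : Q) : LatticeCon D.Lat where
  r := Lat.Sim r
  iseqv := ⟨Lat.Sim.refl r, Lat.Sim.symm, Lat.Sim.trans⟩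
  inf := Lat.Sim.inf
  sup {w x y z} h h' := by
    have h₁ := h.sup_right y
    have h₂ := h'.sup_right x
    rw [sup_comm y x, sup_comm z x] at h₂
    exact h₁.trans h₂

theorem collapsesColor_colorCon (r : Q) : CollapsesColor (D.colorCon r) r := by
  refine ⟨?_, ?_⟩
  · rintro (i | ⟨i, p, s⟩ | ⟨i, n⟩) hg
    · exact Iff.rfl
    · cases s
      · exact ⟨fun h => ⟨h.1, h.2.1, nofun⟩, fun h => ⟨h.1, h.2.1, nofun⟩⟩
      · refine ⟨fun h => absurd (h.2.2 rfl) (by decide), fun h => absurd (.inr ⟨rfl, h.2.1.le⟩) hg⟩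
    · refine ⟨fun h => absurd h.2.2.1 (by decide), fun h => absurd ?_ hg⟩
      obtain ⟨rfl, h, -⟩ := h
      exact h.ge
  · exact Iff.rfl

theorem CollapsesColor.rel_of_sim {θ : LatticeCon D.Lat} {r : Q} (h : CollapsesColor θ r)
    {x y : D.Lat} (hxy : Lat.Sim r x y) : θ.r x y := by
  have key {a b : D.Lat} (hab : a ≤ b) (h' : Lat.Sim r a b) : θ.r a b := by
    obtain ⟨k, hk⟩ := h'.exists_le_of_absorbs
    obtain ⟨e, he, heθ⟩ := exists_absorbs r k a
    exact rel_of_mem_interval (heθ θ h) le_rfl hab (hk a e le_rfl he)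
  have h₁ := hxy.inf (Lat.Sim.refl r y)
  have h₂ := (Lat.Sim.refl r x).inf hxy
  rw [inf_idem] at h₁ h₂
  exact θ.iseqv.trans (θ.iseqv.symm (key inf_le_left h₂.symm)) (key inf_le_right h₁)

theorem colorCon_le_iff {θ : LatticeCon D.Lat} {r : Q} : D.colorCon r ≤ θ ↔ CollapsesColor θ r :=
  ⟨fun h => h (collapsesColor_colorCon r), fun h _ _ => h.rel_of_sim⟩

/-- Unless `r ≤ s`, the generator `a (rank r) r true` is not neglected by color `s`, and it
separates the two ends of the interval of color `r`. -/
theorem collapsesColor_colorCon_iff {r s : Q} : CollapsesColor (D.colorCon s) r ↔ r ≤ s := by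
  refine ⟨fun h => ?_, fun h => Collapses.of_le h (collapsesColor_colorCon s) _⟩
  by_contra hrs
  have := (h.1 (.a (D.rank r) r true) ?_).2 ⟨rfl, rfl, id⟩
  · exact absurd (this.2.2 rfl) (by decide)
  · rintro (h' | h')
    · exact hrs (h'.le_of_rank_le le_rfl)
    · exact hrs h'.2

theorem colorCon_le_colorCon_iff {r s : Q} : D.colorCon r ≤ D.colorCon s ↔ r ≤ s :=
  colorCon_le_iff.trans collapsesColor_colorCon_iff

theorem colorCon_eq_con (r : Q) : D.colorCon r =
    con (A (D.rank r) r le_rfl false).toLat (A (D.rank r) r le_rfl true : D.Elt).toLat :=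
  le_antisymm (colorCon_le_iff.2 ((isLeast_con _ _).1))
    ((isLeast_con _ _).2 (collapsesColor_colorCon r))

end CofinalTower

/-! ### Every strict pair generates the congruence of a color -/

namespace CofinalTower
variable {Q C : Type u} [PartialOrder Q] [LinearOrder C] {D : CofinalTower Q C}
variable [WellFoundedLT C]

open Elt

/-- The pair `x ≤ y` generates the congruence of color `r`. -/
def HasColor (x y : D.Elt) (r : Q) : Prop :=
  Lat.Sim r x.toLat y.toLat ∧ ∀ θ : LatticeCon D.Lat, θ.r x.toLat y.toLat → CollapsesColor θ r

/-- `G` is a part of `y` that meets `x` only in floors from `d` on. If `c` is the floor of `x` seen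
from `d`, meeting with `G` identifies `zero c` and `G`. Either `c = d` and two of the `W` complement
`G`, or `c > d` and `zero d` is identified with `zero c`; both collapse level `c`. -/
theorem exists_rel_zero_one {x y G : D.Elt} {d : C}
    (hG : ∀ g, G.Has g → x.Has g → ∃ i, g = .o i ∧ d ≤ i) (hd : G.Has (.o d))
    (hy : G.toLat ≤ y.toLat)
    (h : ¬ x.Has (.o d) ∨ ∃ n m, n ≠ m ∧ (one d : D.Elt).toLat ≤ (W d n).toLat ⊔ G.toLat ∧
      (one d : D.Elt).toLat ≤ (W d m).toLat ⊔ G.toLat) :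
    ∃ c, d ≤ c ∧ (∀ i, d ≤ i → (x.Has (.o i) ↔ c ≤ i)) ∧ ∀ θ : LatticeCon D.Lat,
      θ.r x.toLat y.toLat → θ.r (zero c : D.Elt).toLat (one c : D.Elt).toLat := by
  obtain ⟨c, hdc, hc⟩ := x.exists_zero_index d
  refine ⟨c, hdc, hc, fun θ hθ => ?_⟩
  have h₁ : θ.r (zero c : D.Elt).toLat G.toLat := by
    refine rel_of_inf_le (z := G.toLat) hθ (inf_toLat_le fun g hg hg' => ?_)
      (zero_le (hd.o_mono hdc)) hy le_rfl
    obtain ⟨i, rfl, hi⟩ := hG g hg' hg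
    exact (hc i hi).1 hg
  rcases hdc.eq_or_lt with rfl | hlt
  · obtain ⟨n, m, hnm, hn, hm⟩ := h.resolve_left fun h => h ((hc d le_rfl).2 le_rfl)
    exact rel_zero_one h₁ hnm hn hm
  · exact rel_zero_one (x := zero d)
      (rel_of_mem_interval h₁ le_rfl (zero_le hdc) (zero_le hd)) (n := 0) (m := 1)
      (by decide) (one_le_W_sup_zero hlt) (one_le_W_sup_zero hlt)

/-- The pair lies between `zero c` and `one c` and collapses that interval, so it generates exactly
the color `chain c`. -/
theorem hasColor_of_rel_zero_one {x y : D.Elt} {c : C} (hxy : x.toLat ≤ y.toLat)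
    (hx : x.Has (.o c)) (hy : y.level ≤ c) (h : ∀ θ : LatticeCon D.Lat,
      θ.r x.toLat y.toLat → θ.r (zero c : D.Elt).toLat (one c : D.Elt).toLat) :
    HasColor x y (D.chain c) :=
  ⟨rel_of_mem_interval (c := D.colorCon (D.chain c))
    ((collapsesColor_colorCon (D.chain c)).rel_zero_one le_rfl) (zero_le hx) hxy (le_one hy),
    fun θ hθ => Collapses.change_level (collapses_of_rel_zero_one (h θ hθ)) _⟩

theorem hasColor_of_not_has_a {x y : D.Elt} {d : C} {p : Q} (hp : D.rank p ≤ d)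
    (hxy : x.toLat ≤ y.toLat) (hy : y.level ≤ d) (hx : ¬ x.Has (.a d p false))
    (hya : y.Has (.a d p false)) : ∃ r, HasColor x y r := by
  have hG : ∀ g, (A d p hp false).Has g → x.Has g → ∃ i, g = .o i ∧ d ≤ i := by
    rintro (i | ⟨i, q, s⟩ | ⟨i, n⟩) hg hg'
    · exact ⟨i, rfl, hg⟩
    · obtain ⟨rfl, rfl, -⟩ := hg
      exact absurd hg'.a_false hx
    · exact absurd hg.2.2.1 (by decide)
  obtain ⟨c, hdc, hc, h⟩ := exists_rel_zero_one hG le_rfl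
    (A_le_of_has hp hya) (.inr ⟨1, 2, by decide, one_le_W_sup_A hp _ (by decide),
      one_le_W_sup_A hp _ (by decide)⟩)
  exact ⟨_, hasColor_of_rel_zero_one hxy ((hc c hdc).2 le_rfl) (hy.trans hdc) h⟩

theorem exists_rel_zero_one_of_not_has_w {x y : D.Elt} {d : C} {n : Fin 3}
    (hx : ¬ x.Has (.w d n)) (hyw : y.Has (.w d n)) :
    ∃ c, d ≤ c ∧ (∀ i, d ≤ i → (x.Has (.o i) ↔ c ≤ i)) ∧ ∀ θ : LatticeCon D.Lat,
      θ.r x.toLat y.toLat → θ.r (zero c : D.Elt).toLat (one c : D.Elt).toLat := by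
  refine exists_rel_zero_one (G := W d n) (d := d) ?_ le_rfl
    (W_le_of_has hyw) (.inr ?_)
  · rintro (i | ⟨i, q, s⟩ | ⟨i, m⟩) hg hg'
    · exact ⟨i, rfl, hg⟩
    · exact hg.elim
    · obtain ⟨rfl, rfl⟩ := hg
      exact absurd hg' hx
  · obtain ⟨k, m, h, hk, hm⟩ : ∃ k m : Fin 3, k ≠ m ∧ k ≠ n ∧ m ≠ n := by
      clear hx hyw
      revert n; decide
    exact ⟨k, m, h, one_le_W_sup_W hk, one_le_W_sup_W hm⟩

theorem hasColor_of_not_has_w {x y : D.Elt} {d : C} {n : Fin 3}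
    (hxy : x.toLat ≤ y.toLat) (hy : y.level ≤ d)
    (hx : ¬ x.Has (.w d n)) (hyw : y.Has (.w d n)) : ∃ r, HasColor x y r := by
  obtain ⟨c, hdc, hc, h⟩ := exists_rel_zero_one_of_not_has_w hx hyw
  exact ⟨_, hasColor_of_rel_zero_one hxy ((hc c hdc).2 le_rfl) (hy.trans hdc) h⟩

theorem hasColor_of_not_has_o {x y : D.Elt} {d : C} (hxy : x.toLat ≤ y.toLat)
    (hx : ¬ x.Has (.o d)) (hyo : y.Has (.o d)) (hy : ∀ c, x.Has (.o c) → y.level ≤ c) :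
    ∃ r, HasColor x y r := by
  have hG : ∀ g, (zero d : D.Elt).Has g → x.Has g → ∃ i, g = .o i ∧ d ≤ i := by
    rintro (i | ⟨i, q, s⟩ | ⟨i, m⟩) hg hg'
    exacts [⟨i, rfl, hg⟩, hg.elim, hg.elim]
  obtain ⟨c, hdc, hc, h⟩ := exists_rel_zero_one hG le_rfl (zero_le hyo) (.inl hx)
  have hxc := (hc c hdc).2 le_rfl
  exact ⟨_, hasColor_of_rel_zero_one hxy hxc (hy c hxc) h⟩

theorem collapsesColor_of_has_a {x y : D.Elt} {d : C} {p : Q} (hp : D.rank p ≤ d)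
    (hx : x.Has (.a d p false)) (hx' : ¬ x.Has (.a d p true)) (hy : y.Has (.a d p true))
    (θ : LatticeCon D.Lat) (h : θ.r x.toLat y.toLat) : CollapsesColor θ p := by
  refine Collapses.change_level (hp := hp) (rel_of_inf_le (z := (A d p hp true).toLat) h
    (inf_toLat_le ?_) (A_false_le_true hp) (A_le_of_has hp hy) le_rfl) _
  rintro (i | ⟨i, q, s⟩ | ⟨i, m⟩) hg hg'
  · exact hg'
  · obtain ⟨rfl, rfl, -⟩ := hg'
    refine ⟨rfl, rfl, fun hs => absurd (hs ▸ hg) hx'⟩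
  · obtain ⟨rfl, h₁, -, rfl⟩ := hg'
    exact absurd (hx.a_true_of_w hg h₁) hx'

theorem hasColor_of_lt_tail {x : D.Elt} {d : C} {p : Q} (hp : D.rank p < d) {y : D.Elt}
    (hy : y.level = d) (hya : y.Has (.a d p false)) (hyo : y.Has (.o (D.rank p)))
    (hxy : x.toLat ≤ y.toLat) (hx : ¬ (Tu d p hp).toLat ≤ x.toLat) : ∃ r, HasColor x y r := by
  by_cases ha : x.Has (.a d p false)
  · by_cases ho : x.Has (.o (D.rank p))
    · exact absurd (Tu_le_of_has hp ha ho) hx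
    · refine hasColor_of_not_has_o hxy ho hyo fun c hc => ?_
      rw [hy]
      exact le_of_not_gt fun h => ho (ha.rank_of_lt hc h hp.le).1
  · exact hasColor_of_not_has_a hp.le hxy hy.le ha hya

/-- Look for a generator of `y` missing from `x`. A missing floor, `w` or unmarked `a` collapses a
whole level, and the color is some `chain c`. If only marks `a d p true` are missing, the color is
the largest one whose mark is missing. -/
theorem exists_hasColor {x y : D.Elt} (h : x.toLat < y.toLat) : ∃ r, HasColor x y r := by
  have hxy := h.le
  have hyx := h.not_ge
  cases y with
  | zero d =>
    refine hasColor_of_not_has_o (d := d) hxy (fun h => hyx (zero_le h)) le_rfl fun c hc => hxy hc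
  | one d =>
    by_cases h₁ : x.Has (.w d 1)
    · exact hasColor_of_not_has_w (d := d) (n := 2) hxy le_rfl
        (fun h₂ => hyx (one_le_of_has h₁ h₂)) le_rfl
    · exact hasColor_of_not_has_w (d := d) hxy le_rfl h₁ le_rfl
  | W d n => exact hasColor_of_not_has_w hxy le_rfl (fun h => hyx (W_le_of_has h)) ⟨rfl, rfl⟩
  | A d p hp s =>
    by_cases ha : x.Has (.a d p false)
    · cases s
      · exact absurd (A_le_of_has hp ha) hyx
      · have hb : ¬ x.Has (.a d p true) := fun h => hyx (A_le_of_has hp h)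
        exact ⟨p, rel_of_mem_interval (c := D.colorCon p)
          ((collapsesColor_colorCon p).collapses le_rfl hp) (A_le_of_has hp ha) hxy le_rfl,
          collapsesColor_of_has_a hp ha hb ⟨rfl, rfl, id⟩⟩
    · exact hasColor_of_not_has_a hp hxy le_rfl ha ⟨rfl, rfl, nofun⟩
  | H d p q hpq hp hq s t hts =>
    by_cases hap : x.Has (.a d p false)
    · by_cases haq : x.Has (.a d q false)
      · have hle : (H d p q hpq hp hq false false id).toLat ≤ x.toLat := by
          refine toLat_le ?_
          rintro (i | ⟨i, q, s⟩ | ⟨i, m⟩) hg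
          · exact hap.o_level.o_mono hg
          · cases s
            · obtain ⟨rfl, ⟨rfl, -⟩ | ⟨rfl, -⟩⟩ := hg
              exacts [hap, haq]
            · rcases hg.2 with h | h <;> exact absurd (h.2 rfl) (by decide)
          · exact absurd hg.2.2.1 (by decide)
        by_cases hb : t = true ∧ ¬ x.Has (.a d q true)
        · obtain ⟨rfl, hb⟩ := hb
          exact ⟨q, rel_of_mem_interval (c := D.colorCon q)
            (((collapsesColor_colorCon q).collapses le_rfl hq).rel_H hpq hp _) hle hxy
            (H_mono _ _ _ _ _ (fun _ => rfl) id),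
            collapsesColor_of_has_a hq haq hb ⟨rfl, .inr ⟨rfl, id⟩⟩⟩
        · have hb' : s = true ∧ ¬ x.Has (.a d p true) := by
            by_contra hs
            refine hyx (toLat_le ?_)
            have e₁ : t = true → x.Has (.a d q true) := by tauto
            have e₂ : s = true → x.Has (.a d p true) := by tauto
            rintro (i | ⟨i, q, b⟩ | ⟨i, m⟩) hg
            · exact hap.o_level.o_mono hg
            · cases b
              · obtain ⟨rfl, ⟨rfl, -⟩ | ⟨rfl, -⟩⟩ := hg
                exacts [hap, haq]
              · obtain ⟨rfl, ⟨rfl, h'⟩ | ⟨rfl, h'⟩⟩ := hg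
                exacts [e₂ (h' rfl), e₁ (h' rfl)]
            · obtain ⟨rfl, h₁, h₂, rfl⟩ := hg
              exact (e₁ h₂).w_of_a_true h₁
          obtain ⟨rfl, hb'⟩ := hb'
          -- If `t` were true, `x` would have the mark of `q`, which forces the mark of the smaller
          -- color `p`.
          have ht : t = false := by
            rw [← Bool.not_eq_true]
            exact fun ht => hb ⟨ht, fun h => hb' (hap.a_true_of_lt hpq h)⟩
          subst ht
          exact ⟨p, rel_of_mem_interval (c := D.colorCon p)
            (((collapsesColor_colorCon p).collapses le_rfl hp).rel_H_left hpq hq id) hle hxy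
            le_rfl, collapsesColor_of_has_a hp hap hb' ⟨rfl, .inl ⟨rfl, id⟩⟩⟩
      · exact hasColor_of_not_has_a hq hxy le_rfl haq ⟨rfl, .inr ⟨rfl, nofun⟩⟩
    · exact hasColor_of_not_has_a hp hxy le_rfl hap ⟨rfl, .inl ⟨rfl, nofun⟩⟩
  | Tu d p hp =>
    exact hasColor_of_lt_tail hp rfl ⟨.inl rfl, rfl, rfl⟩ le_rfl hxy hyx
  | Tv d p hp =>
    by_cases hu : (Tu d p hp).toLat ≤ x.toLat
    · have hb : ¬ x.Has (.a d p true) := fun h => hyx ((Tv_le_Tu_sup_high hp).trans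
        (sup_le hu (A_le_of_has hp.le h)))
      exact ⟨p, rel_of_mem_interval (c := D.colorCon p)
        (rel_Tu_Tv_of_low hp (collapsesColor_colorCon p)) hu hxy le_rfl,
        collapsesColor_of_has_a hp.le (hu (⟨.inl rfl, rfl, rfl⟩ : (Tu d p hp).Has (.a d p false)))
          hb ⟨.inl rfl, rfl⟩⟩
    · exact hasColor_of_lt_tail hp rfl ⟨.inl rfl, rfl⟩ le_rfl hxy hu
  | Tj d p k hp hk =>
    have hpd := hp.trans_lt hk
    by_cases hu : (Tu d p hpd).toLat ≤ x.toLat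
    · have ha : x.Has (.a d p false) :=
        hu (⟨.inl rfl, rfl, rfl⟩ : (Tu d p hpd).Has (.a d p false))
      have ho : x.Has (.o (D.rank p)) := hu (le_rfl : (Tu d p hpd).Has (.o (D.rank p)))
      have hw : ¬ x.Has (.w k 1) := fun h => hyx (Tj_le_of_has hp hk ha ho h)
      obtain ⟨c, hkc, hc, hθ⟩ := exists_rel_zero_one_of_not_has_w (y := Tj d p k hp hk) hw le_rfl
      -- The floor of `x` is at `rank p ≤ k` or lower, so seen from `k` it is `k` itself.
      obtain rfl : c = k := le_antisymm ((hc k le_rfl).1 (ho.o_mono hp)) hkc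
      refine ⟨D.chain c, ?_, fun θ h => Collapses.change_level (collapses_of_rel_zero_one (hθ θ h)) _⟩
      exact rel_of_le_sup (c := D.colorCon (D.chain c))
        ((collapsesColor_colorCon (D.chain c)).rel_zero_one le_rfl) (zero_le (ho.o_mono hp)) hxy
        (Tj_le_sup_one hp hk ha)
    · exact hasColor_of_lt_tail hpd rfl (.inr ⟨rfl, rfl⟩) trivial hxy hu

end CofinalTower


/-! ### Principal congruences of an arbitrary lattice -/

section Princ

variable {L : Type u} [Lattice L]

theorem con_le_iff {a b : L} {c : LatticeCon L} : con a b ≤ c ↔ c.r a b :=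
  ⟨fun h => h (isLeast_con a b).1, fun h => (isLeast_con a b).2 h⟩

theorem con_inf_sup (a b : L) : con (a ⊓ b) (a ⊔ b) = con a b :=
  le_antisymm (con_le_iff.2 ((con a b).r_inf_sup_iff.2 (isLeast_con a b).1))
    (con_le_iff.2 ((con (a ⊓ b) (a ⊔ b)).r_inf_sup_iff.1 (isLeast_con _ _).1))

theorem con_self_le (a : L) (c : LatticeCon L) : con a a ≤ c := con_le_iff.2 (c.iseqv.refl a)

theorem eq_of_con_self {a x y : L} (h : (con a a).r x y) : x = y :=
  h { r := Eq
      iseqv := eq_equivalence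
      inf := by rintro _ _ _ _ rfl rfl; rfl
      sup := by rintro _ _ _ _ rfl rfl; rfl } rfl

theorem countable_princ [Countable L] : Countable (Princ L) :=
  Function.Surjective.countable (f := fun x : L × L => (⟨con x.1 x.2, x.1, x.2, rfl⟩ : Princ L))
    fun ⟨_, a, b, h⟩ => ⟨(a, b), Subtype.ext h.symm⟩

theorem exists_upper_bound_princ (c d : Princ L) : ∃ e : Princ L, c ≤ e ∧ d ≤ e := by
  obtain ⟨_, a, b, rfl⟩ := c
  obtain ⟨_, a', b', rfl⟩ := d
  have h := (isLeast_con (a ⊓ b ⊓ (a' ⊓ b')) (a ⊔ b ⊔ (a' ⊔ b'))).1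
  refine ⟨⟨con (a ⊓ b ⊓ (a' ⊓ b')) (a ⊔ b ⊔ (a' ⊔ b')), _, _, rfl⟩, ?_, ?_⟩
  · change con a b ≤ _
    rw [← con_inf_sup a b]
    exact con_le_iff.2 (rel_of_mem_interval h inf_le_left inf_le_sup le_sup_left)
  · change con a' b' ≤ _
    rw [← con_inf_sup a' b']
    exact con_le_iff.2 (rel_of_mem_interval h inf_le_right inf_le_sup le_sup_right)

end Princ

/-! ### Countability, and the isomorphism with the poset -/

namespace CofinalTower
variable {Q C : Type u} [PartialOrder Q] [LinearOrder C] {D : CofinalTower Q C}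

/-- An injective coding of names. -/
def Elt.code : D.Elt → ℕ × C × C × Option Q × Option Q × Fin 3 × Bool × Bool
  | .zero c => (0, c, c, none, none, 0, false, false)
  | .one c => (1, c, c, none, none, 0, false, false)
  | .A c p _ s => (2, c, c, some p, none, 0, s, false)
  | .W c n => (3, c, c, none, none, n, false, false)
  | .H c p q _ _ _ s t _ => (4, c, c, some p, some q, 0, s, t)
  | .Tu c p _ => (5, c, c, some p, none, 0, false, false)
  | .Tv c p _ => (6, c, c, some p, none, 0, false, false)
  | .Tj c p k _ _ => (7, c, k, some p, none, 0, false, false)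

theorem Elt.code_injective : Function.Injective (Elt.code (D := D)) := by
  intro x y h
  cases x <;> cases y <;> simp_all [Elt.code]

theorem countable_lat [Countable Q] [Countable C] : Countable D.Lat :=
  have : Countable D.Elt := Elt.code_injective.countable
  Function.Surjective.countable (f := Elt.toLat (D := D)) Lat.exists_name

variable [WellFoundedLT C]

theorem exists_con_eq_colorCon {x y : D.Lat} (h : x ≠ y) : ∃ r, con x y = D.colorCon r := by
  have hlt : x ⊓ y < x ⊔ y := inf_lt_sup.2 h
  obtain ⟨a, ha⟩ := Lat.exists_name (x ⊓ y)
  obtain ⟨b, hb⟩ := Lat.exists_name (x ⊔ y)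
  rw [← ha, ← hb] at hlt
  obtain ⟨r, h₁, h₂⟩ := exists_hasColor hlt
  refine ⟨r, ?_⟩
  rw [← con_inf_sup, ← ha, ← hb]
  exact le_antisymm (con_le_iff.2 h₁) (colorCon_le_iff.2 (h₂ _ (isLeast_con _ _).1))

theorem not_colorCon_le_con_self (r : Q) (x : D.Lat) : ¬ D.colorCon r ≤ con x x := by
  intro h
  have h₁ := eq_of_con_self (colorCon_le_iff.1 h)
  have h₂ : (Elt.A (D.rank r) r le_rfl true).toLat.Has (.a (D.rank r) r true) := ⟨rfl, rfl, id⟩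
  rw [← h₁] at h₂
  exact absurd (h₂.2.2 rfl) (by decide)

end CofinalTower

open CofinalTower

theorem exists_lattice_of_tower {P : Type u} [PartialOrder P] {z : P} (hz : ∀ x, z ≤ x)
    {C : Type u} [LinearOrder C] [WellFoundedLT C] [Nonempty C]
    (D : CofinalTower {p : P // p ≠ z} C) : Nonempty D.Lat ∧ Nonempty (P ≃o Princ D.Lat) := by
  classical
  obtain ⟨c⟩ := ‹Nonempty C›
  let o : D.Lat := (Elt.zero c).toLat
  refine ⟨⟨o⟩, ⟨?_⟩⟩
  let f : P → Princ D.Lat := fun p =>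
    if h : p = z then ⟨con o o, o, o, rfl⟩ else ⟨D.colorCon ⟨p, h⟩, _, _, colorCon_eq_con _⟩
  have hfz : f z = ⟨con o o, o, o, rfl⟩ := dif_pos rfl
  have hf (p : P) (h : p ≠ z) : f p = ⟨D.colorCon ⟨p, h⟩, _, _, colorCon_eq_con _⟩ := dif_neg h
  have hle (p q : P) : f p ≤ f q ↔ p ≤ q := by
    by_cases hp : p = z
    · subst hp
      rw [hfz]
      exact iff_of_true (con_self_le o _) (hz q)
    · by_cases hq : q = z
      · subst hq
        rw [hfz, hf p hp]
        exact iff_of_false (not_colorCon_le_con_self _ o) fun h => hp (h.antisymm (hz p))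
      · rw [hf p hp, hf q hq]
        exact colorCon_le_colorCon_iff
  refine RelIso.ofSurjective (OrderEmbedding.ofMapLEIff f hle) ?_
  rintro ⟨_, a, b, rfl⟩
  by_cases hab : a = b
  · subst hab
    exact ⟨z, hfz.trans (Subtype.ext (le_antisymm (con_self_le _ _) (con_self_le _ _)))⟩
  · obtain ⟨r, hr⟩ := exists_con_eq_colorCon hab
    exact ⟨r.1, (hf r.1 r.2).trans (Subtype.ext hr.symm)⟩

/-- Keep the elements that exceed everything preceding them in an arbitrary well-ordering. On these,
the given order is contained in the well-ordering. -/
theorem exists_wellFounded_cofinal (α : Type u) [LinearOrder α] :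
    ∃ S : Set α, IsCofinal S ∧ WellFoundedLT S := by
  refine ⟨_, isCofinal_setOfPred_imp_lt WellOrderingRel, ⟨?_⟩⟩
  refine Subrelation.wf (r := InvImage WellOrderingRel Subtype.val) ?_
    (InvImage.wf _ IsWellFounded.wf)
  rintro ⟨a, ha⟩ ⟨b, hb⟩ h
  rcases trichotomous_of WellOrderingRel a b with h' | h' | h'
  · exact h'
  · exact absurd h' (ne_of_lt h)
  · exact absurd (ha b h') (lt_asymm h)

theorem exists_tower {Q : Type u} [PartialOrder Q] (h : HasCofinalChain Q) :
    ∃ (T : Type u) (_ : LinearOrder T), WellFoundedLT T ∧ (Nonempty Q → Nonempty T) ∧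
      (Countable Q → Countable T) ∧ Nonempty (CofinalTower Q T) := by
  classical
  obtain ⟨C, hC, hcof⟩ := h
  let _ : LinearOrder C := hC.linearOrder
  obtain ⟨S, hS, hwf⟩ := exists_wellFounded_cofinal C
  let g : S ↪o Q := ⟨⟨fun s => s.1.1, Subtype.val_injective.comp Subtype.val_injective⟩, Iff.rfl⟩
  have hg (p : Q) : ∃ s, p ≤ g s := by
    obtain ⟨c, hc, hpc⟩ := hcof p
    obtain ⟨s, hs, hcs⟩ := hS ⟨c, hc⟩
    exact ⟨⟨s, hs⟩, hpc.trans hcs⟩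
  -- A member of the chain must receive its own index as rank, any other element the index of some
  -- upper bound.
  have hr (p : Q) : ∃ s, p ≤ g s ∧ ∀ t, g t = p → t = s := by
    by_cases hp : ∃ t, g t = p
    · obtain ⟨t, rfl⟩ := hp
      exact ⟨t, le_rfl, fun _ h => g.injective h⟩
    · obtain ⟨s, hs⟩ := hg p
      exact ⟨s, hs, fun t ht => absurd ⟨t, ht⟩ hp⟩
  choose rank hrank hrank' using hr
  refine ⟨S, inferInstance, hwf, fun ⟨q⟩ => ⟨rank q⟩, fun _ => g.injective.countable,
    ⟨⟨g, rank, hrank, fun c => (hrank' _ c rfl).symm⟩⟩⟩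

theorem hasCofinalChain_ne {P : Type u} [PartialOrder P] {z : P} (hz : ∀ x, z ≤ x)
    (h : HasCofinalChain P) : HasCofinalChain {p : P // p ≠ z} := by
  obtain ⟨C, hC, hcof⟩ := h
  refine ⟨{q | q.1 ∈ C}, fun a ha b hb hab => hC ha hb fun h => hab (Subtype.ext h), fun q => ?_⟩
  obtain ⟨c, hc, hqc⟩ := hcof q.1
  exact ⟨⟨c, fun h => q.2 ((hqc.trans h.le).antisymm (hz _))⟩, hc, hqc⟩

theorem exists_lattice_of_hasCofinalChain {P : Type u} [PartialOrder P] {z : P}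
    (hz : ∀ x, z ≤ x) (h : HasCofinalChain P) :
    ∃ (L : Type u) (_ : Lattice L), Nonempty L ∧ (Countable P → Countable L) ∧
      Nonempty (P ≃o Princ L) := by
  by_cases hQ : Nonempty {p : P // p ≠ z}
  · obtain ⟨T, _, _, hT, hcount, ⟨D⟩⟩ := exists_tower (hasCofinalChain_ne hz h)
    have := hT hQ
    obtain ⟨h₁, h₂⟩ := exists_lattice_of_tower hz D
    refine ⟨D.Lat, inferInstance, h₁, fun hP => ?_, h₂⟩
    have := hcount inferInstance
    exact countable_lat
  -- Without colors there are no levels to build on; the one-point lattice serves instead.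
  · have hP : Subsingleton P := by
      have hall (p : P) : p = z := by_contra fun hp => hQ ⟨p, hp⟩
      exact ⟨fun p q => (hall p).trans (hall q).symm⟩
    refine ⟨PUnit, inferInstance, inferInstance, fun _ => inferInstance, ⟨?_⟩⟩
    have hsub : Subsingleton (Princ PUnit.{u + 1}) :=
      ⟨fun ⟨_, a, b, h⟩ ⟨_, a', b', h'⟩ => by subst h h'; rfl⟩
    exact ⟨⟨fun _ => ⟨con ⟨⟩ ⟨⟩, _, _, rfl⟩, fun _ => z, fun _ => Subsingleton.elim _ _,
      fun _ => Subsingleton.elim _ _⟩,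
      fun {a b} => iff_of_true (Subsingleton.elim _ _).le (Subsingleton.elim a b).le⟩

/-! ### Cofinal chains and the countable case -/

theorem isUnionOfChainOfPrincipalIdeals_iff (P : Type u) [PartialOrder P] :
    IsUnionOfChainOfPrincipalIdeals P ↔ HasCofinalChain P := by
  constructor
  · rintro ⟨S, hS, hchain, hU⟩
    refine ⟨{c | Set.Iic c ∈ S}, fun a ha b hb hab => ?_, fun x => ?_⟩
    · exact (hchain ha hb (Set.Iic_injective.ne hab)).imp Set.Iic_subset_Iic.1 Set.Iic_subset_Iic.1
    · obtain ⟨I, hI, hx⟩ : x ∈ ⋃₀ S := hU ▸ Set.mem_univ x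
      obtain ⟨c, rfl⟩ := hS I hI
      exact ⟨c, hI, hx⟩
  · rintro ⟨C, hC, hcof⟩
    refine ⟨Set.Iic '' C, ?_, ?_, ?_⟩
    · rintro _ ⟨c, -, rfl⟩
      exact ⟨c, rfl⟩
    · rintro _ ⟨a, ha, rfl⟩ _ ⟨b, hb, rfl⟩ hab
      exact (hC ha hb fun h => hab (h ▸ rfl)).imp Set.Iic_subset_Iic.2 Set.Iic_subset_Iic.2
    · refine Set.eq_univ_of_forall fun x => ?_
      obtain ⟨c, hc, hx⟩ := hcof x
      exact ⟨_, ⟨c, hc, rfl⟩, hx⟩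

theorem hasCofinalChain_of_countable (P : Type u) [PartialOrder P] [Countable P] [Nonempty P]
    [IsDirectedOrder P] : HasCofinalChain P := by
  obtain ⟨f, hf, hlim⟩ := Filter.exists_seq_monotone_tendsto_atTop_atTop P
  refine ⟨Set.range f, hf.isChain_range, fun x => ?_⟩
  obtain ⟨n, hn⟩ := (hlim.eventually_ge_atTop x).exists
  exact ⟨_, ⟨n, rfl⟩, hn⟩

/-- A countable poset has a copy in every universe, so the lattice need not live in the universe of
the poset. -/
theorem exists_orderIso_of_countable (P : Type u) [PartialOrder P] [Countable P] :
    ∃ (P' : Type v) (_ : PartialOrder P'), Nonempty (P ≃o P') := by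
  obtain ⟨X, ⟨e⟩⟩ : ∃ X : Type v, Nonempty (P ≃ X) := by
    obtain ⟨f, hf⟩ := exists_injective_nat P
    exact ⟨ULift (Set.range f), ⟨(Equiv.ofInjective f hf).trans Equiv.ulift.symm⟩⟩
  let _ : PartialOrder X := PartialOrder.lift e.symm e.symm.injective
  refine ⟨X, inferInstance, ⟨⟨e, fun {a b} => ?_⟩⟩⟩
  change e.symm (e a) ≤ e.symm (e b) ↔ a ≤ b
  simp

theorem exists_countable_lattice_iff (P : Type u) [PartialOrder P] :
    (∃ (L : Type v) (_ : Lattice L), Nonempty L ∧ Countable L ∧ Nonempty (P ≃o Princ L)) ↔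
      (Countable P ∧ IsDirectedOrder P ∧ ∃ z : P, ∀ x : P, z ≤ x) := by
  constructor
  · rintro ⟨L, _, ⟨a⟩, _, ⟨e⟩⟩
    have := countable_princ (L := L)
    refine ⟨e.injective.countable, ⟨fun p q => ?_⟩,
      e.symm ⟨con a a, a, a, rfl⟩, fun x => e.symm_apply_le.2 (con_self_le a _)⟩
    obtain ⟨c, h₁, h₂⟩ := exists_upper_bound_princ (e p) (e q)
    exact ⟨e.symm c, e.le_symm_apply.2 h₁, e.le_symm_apply.2 h₂⟩
  · rintro ⟨_, _, z, hz⟩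
    obtain ⟨P', _, ⟨e⟩⟩ := exists_orderIso_of_countable.{u, v} P
    have : Countable P' := e.symm.injective.countable
    have : Nonempty P' := ⟨e z⟩
    have : IsDirectedOrder P' := by
      refine ⟨fun p q => ?_⟩
      obtain ⟨r, h₁, h₂⟩ := exists_ge_ge (e.symm p) (e.symm q)
      exact ⟨e r, e.symm_apply_le.1 h₁, e.symm_apply_le.1 h₂⟩
    obtain ⟨L, _, h₁, h₂, ⟨e'⟩⟩ := exists_lattice_of_hasCofinalChain (z := e z)
      (fun x => e.le_symm_apply.1 (hz _)) (hasCofinalChain_of_countable P')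
    exact ⟨L, inferInstance, h₁, h₂ inferInstance, ⟨e.trans e'⟩⟩

end PrincCong

theorem theorem1p1 (P : Type u) [PartialOrder P] :
    -- (i)
    ((∃ (L : Type v) (_ : Lattice L),
        Nonempty L ∧ Countable L ∧ Nonempty (P ≃o PrincCong.Princ L)) ↔
      (Countable P ∧ IsDirectedOrder P ∧ ∃ z : P, ∀ x : P, z ≤ x)) ∧
    -- (ii)
    ((∃ z : P, ∀ x : P, z ≤ x) → PrincCong.IsUnionOfChainOfPrincipalIdeals P →
      ∃ (L : Type u) (_ : Lattice L), Nonempty L ∧ Nonempty (P ≃o PrincCong.Princ L)) ∧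
    -- the alternative form of the hypothesis of (ii)
    (PrincCong.IsUnionOfChainOfPrincipalIdeals P ↔ PrincCong.HasCofinalChain P) := by
  refine ⟨PrincCong.exists_countable_lattice_iff P, fun ⟨z, hz⟩ h => ?_,
    PrincCong.isUnionOfChainOfPrincipalIdeals_iff P⟩
  obtain ⟨L, _, h₁, -, h₂⟩ := PrincCong.exists_lattice_of_hasCofinalChain hz
    ((PrincCong.isUnionOfChainOfPrincipalIdeals_iff P).1 h)
  exact ⟨L, inferInstance, h₁, h₂⟩
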